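/- Let $(M^m,g)$ and $(N^n,h)$ be smooth Riemannian manifolds and let $\varphi:M\to N$ be a smooth almost submersion, i.e. the set of regular points (the points $x$ at which $d\varphi_x$ is surjective) is dense in $M$. Put $\mathcal V=\ker d\varphi$ and $\mathcal H=\mathcal V^{\perp}$. Let $\{E_i,E_\alpha\}$ ($i=1,\dots,n$; $\alpha=1,\dots,m-n$) be a smooth orthonormal frame, on an open set $U$ of regular points, of eigenvectors of the first fundamental form $\varphi^*h$, with $E_i\in\mathcal H$, $E_\alpha\in\mathcal V$, $\varphi^*h(E_i,\cdot)=\lambda_i^2\,g(E_i,\cdot)$ and $\lambda_i\ge 0$. The mean curvature $\mu^{\mathcal D}$ of a distribution $\mathcal D$ is its second fundamental form $(X,Y)\mapsto(\nabla_XY)^{\perp}$ ($X,Y$ sections of $\mathcal D$, $\nabla$ the Levi-Civita connection of $g$) traced over $\mathcal D$ and divided by the rank of $\mathcal D$ (and it is $0$ if $\mathcal D=0$). The energy density is $e(\varphi)=\tfrac12|d\varphi|^2$, and $\varphi$ is harmonic when its tension field $\tau(\varphi)=\mathrm{trace}_g\nabla d\varphi$ vanishes. 1. At every point of $U$, $$\mu^{\mathcal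 H}=\tfrac1n\,\mathrm{grad}^{\mathcal V}\ln(\lambda_1\cdots\lambda_n),$$ where $\mathrm{grad}^{\mathcal V}$ is the vertical part of the gradient (for $n=0$ both sides are $0$). 2. In particular, if $\varphi$ is horizontally weakly conformal with dilation $\lambda$ (at each point either $d\varphi=0$, where $\lambda=0$, or $d\varphi|_{\mathcal H}$ is surjective and conformal with factor $\lambda>0$), then $\mu^{\mathcal H}=\mathrm{grad}^{\mathcal V}\ln\lambda$ on $U$ (again with both sides $0$ for $n=0$). 3. $\varphi$ is harmonic on $U$ if and only if, at every point of $U$ and for all $k=1,\dots,n$, $$E_k[e(\varphi)-\lambda_k^2]=\sum_{i=1}^n(\lambda_i^2-\lambda_k^2)\,g(\nabla_{E_i}E_i,E_k)-(m-n)\,\lambda_k^2\,g(\mu^{\mathcal V},E_k).$$ If such frames are given on a family of open sets whose union is dense in $M$ (for instance a single frame on a dense open set), then $\varphi$ is harmonic on $M$ if and only if these equations hold for each of these frames at every point of its domain. -/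

import Mathlib

open Bundle
open scoped Manifold ContDiff

noncomputable section

namespace RiemMap

instance tangentSpace_finiteDimensional {m : ℕ} {M : Type*} [TopologicalSpace M]
    [ChartedSpace (EuclideanSpace ℝ (Fin m)) M] (x : M) :
    FiniteDimensional ℝ (TangentSpace (𝓡 m) x) :=
  inferInstanceAs (FiniteDimensional ℝ (EuclideanSpace ℝ (Fin m)))

section OneManifold

/-! ### The Levi-Civita connection and distributions on a Riemannian manifold `M` -/

variable {m : ℕ} {M : Type*} [TopologicalSpace M] [ChartedSpace (EuclideanSpace ℝ (Fin m)) M]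

/-- The components of tangent vectors at `x` in the chart centred at `c`. -/
def components (c x : M) : TangentSpace (𝓡 m) x →L[ℝ] EuclideanSpace ℝ (Fin m) :=
  mfderiv (𝓡 m) 𝓘(ℝ, EuclideanSpace ℝ (Fin m)) (extChartAt (𝓡 m) c) x

/-- The tangent vector with prescribed components, at the point of coordinates `y` in the chart
centred at `c`: the differential of the inverse of that chart. -/
def fromChart (c : M) (y : EuclideanSpace ℝ (Fin m)) :
    EuclideanSpace ℝ (Fin m) →L[ℝ] TangentSpace (𝓡 m) ((extChartAt (𝓡 m) c).symm y) :=
  mfderiv 𝓘(ℝ, EuclideanSpace ℝ (Fin m)) (𝓡 m) (extChartAt (𝓡 m) c).symm y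

/-- The tangent vector at the point `x` with prescribed components in the chart centred at `c`. -/
def ofComponents (c x : M) : EuclideanSpace ℝ (Fin m) →L[ℝ] TangentSpace (𝓡 m) x :=
  fromChart c (extChartAt (𝓡 m) c x)

/-- A vector field read in the chart centred at `c`. -/
def chartField (c : M) (Y : Π p : M, TangentSpace (𝓡 m) p) (y : EuclideanSpace ℝ (Fin m)) :
    EuclideanSpace ℝ (Fin m) :=
  components c ((extChartAt (𝓡 m) c).symm y) (Y ((extChartAt (𝓡 m) c).symm y))

variable [RiemannianBundle (fun x : M ↦ TangentSpace (𝓡 m) x)]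

/-- The Riemannian metric read in the chart centred at `c`: `G_y(v, w) = ∑ g_ij(y) v^i w^j`. -/
def chartMetric (c : M) (y : EuclideanSpace ℝ (Fin m)) :
    EuclideanSpace ℝ (Fin m) →L[ℝ] EuclideanSpace ℝ (Fin m) →L[ℝ] ℝ :=
  (innerSL ℝ (E := TangentSpace (𝓡 m) ((extChartAt (𝓡 m) c).symm y))).bilinearComp
    (fromChart c y) (fromChart c y)

/-- Christoffel symbols of the first kind, as the covector
`z ↦ ½ (D_v G(w, z) + D_w G(v, z) - D_z G(v, w))`. -/
def christoffelCovector (c : M) (y v w : EuclideanSpace ℝ (Fin m)) :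
    EuclideanSpace ℝ (Fin m) →L[ℝ] ℝ :=
  let DG := fderiv ℝ (chartMetric c) y
  (1 / 2 : ℝ) • (DG v w + DG w v - (DG.flip v).flip w)

/-- Christoffel symbols of the second kind, `Γ_y(v, w) = ∑ Γ^k_ij(y) v^i w^j ∂_k`: the index is
raised with the inverse of the metric. -/
def christoffel (c : M) (y v w : EuclideanSpace ℝ (Fin m)) : EuclideanSpace ℝ (Fin m) :=
  (chartMetric c y).inverse (christoffelCovector c y v w)

/-- The Levi-Civita covariant derivative `∇_v Y ∈ T_xM` of a vector field `Y` in the direction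
`v ∈ T_xM`, with components `v(Y^k) + Γ^k_ij v^i Y^j` in the chart centred at `x`. -/
def covDeriv (Y : Π p : M, TangentSpace (𝓡 m) p) (x : M) (v : TangentSpace (𝓡 m) x) :
    TangentSpace (𝓡 m) x :=
  ofComponents x x
    (fderiv ℝ (chartField x Y) (extChartAt (𝓡 m) x x) (components x x v) +
      christoffel x (extChartAt (𝓡 m) x x) (components x x v) (components x x (Y x)))

/-- The gradient of a function: `g(grad f, v) = df(v)`. -/
def grad (f : M → ℝ) (x : M) : TangentSpace (𝓡 m) x :=
  (InnerProductSpace.toDual ℝ (TangentSpace (𝓡 m) x)).symm (mvfderiv (𝓡 m) f x)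

/-- The trace with respect to the metric of a bilinear form on `T_xM`: `∑ B(b_i, b_i)` over an
orthonormal basis of `T_xM`. -/
def metricTrace {W : Type*} [AddCommGroup W] {x : M}
    (B : TangentSpace (𝓡 m) x → TangentSpace (𝓡 m) x → W) : W :=
  ∑ i, B (stdOrthonormalBasis ℝ (TangentSpace (𝓡 m) x) i)
    (stdOrthonormalBasis ℝ (TangentSpace (𝓡 m) x) i)

/-- The section of the distribution `D` that extends `w ∈ D_x`: the orthogonal projection to `D`
of the vector field with constant components in the chart centred at `x`. -/
def extendIn (D : Π p : M, Submodule ℝ (TangentSpace (𝓡 m) p)) (x : M)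
    (w : TangentSpace (𝓡 m) x) (p : M) : TangentSpace (𝓡 m) p :=
  (D p).starProjection (ofComponents x p (components x x w))

/-- The second fundamental form `(v, w) ↦ (∇_v W)^⊥` of a distribution `D`, for `v, w ∈ D_x`; it
does not depend on the section `W` of `D` with `W_x = w`. -/
def distSecondFundamentalForm (D : Π p : M, Submodule ℝ (TangentSpace (𝓡 m) p)) (x : M)
    (v w : TangentSpace (𝓡 m) x) : TangentSpace (𝓡 m) x :=
  (D x)ᗮ.starProjection (covDeriv (extendIn D x w) x v)

/-- The mean curvature of a distribution: the trace of its second fundamental form divided by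
its rank. (It is `0` for the zero distribution.) -/
def meanCurvature (D : Π p : M, Submodule ℝ (TangentSpace (𝓡 m) p)) (x : M) :
    TangentSpace (𝓡 m) x :=
  (Module.finrank ℝ (D x) : ℝ)⁻¹ •
    ∑ i, distSecondFundamentalForm D x (stdOrthonormalBasis ℝ (D x) i)
      (stdOrthonormalBasis ℝ (D x) i)

end OneManifold

section Maps

/-! ### Maps `φ : (M, g) → (N, h)` -/

variable {m n : ℕ}
  {M : Type*} [TopologicalSpace M] [ChartedSpace (EuclideanSpace ℝ (Fin m)) M]
  {N : Type*} [TopologicalSpace N] [ChartedSpace (EuclideanSpace ℝ (Fin n)) N]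

/-- The regular points of `φ`: those where its differential is surjective. -/
def regularSet (φ : M → N) : Set M :=
  {x | Function.Surjective (mfderiv (𝓡 m) (𝓡 n) φ x)}

/-- `φ` is submersive on a dense set. -/
def IsAlmostSubmersion (φ : M → N) : Prop :=
  Dense (regularSet (m := m) (n := n) φ)

/-- `𝒱 = ker dφ`. -/
def vertical (φ : M → N) (x : M) : Submodule ℝ (TangentSpace (𝓡 m) x) :=
  LinearMap.ker (mfderiv (𝓡 m) (𝓡 n) φ x).toLinearMap

variable [RiemannianBundle (fun x : M ↦ TangentSpace (𝓡 m) x)]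

/-- `ℋ = 𝒱^⊥`. -/
def horizontal (φ : M → N) (x : M) : Submodule ℝ (TangentSpace (𝓡 m) x) :=
  (vertical (m := m) (n := n) φ x)ᗮ

/-- The vertical part `grad^𝒱 f` of the gradient. -/
def verticalGrad (φ : M → N) (f : M → ℝ) (x : M) : TangentSpace (𝓡 m) x :=
  (vertical (m := m) (n := n) φ x).starProjection (grad f x)

variable [RiemannianBundle (fun y : N ↦ TangentSpace (𝓡 n) y)]

/-- The first fundamental form `φ^*h`. -/
def pullbackMetric (φ : M → N) (x : M) (v w : TangentSpace (𝓡 m) x) : ℝ :=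
  inner ℝ (mfderiv (𝓡 m) (𝓡 n) φ x v) (mfderiv (𝓡 m) (𝓡 n) φ x w)

/-- The energy density `e(φ) = ½ |dφ|² = ½ trace_g φ^*h`. -/
def energyDensity (φ : M → N) (x : M) : ℝ :=
  (1 / 2 : ℝ) * metricTrace (pullbackMetric (m := m) (n := n) φ x)

/-- The second fundamental form `∇dφ(v, w)` of `φ`, with components
`∂²φ̂(v, w) + Γ^N(∂φ̂ v, ∂φ̂ w) - ∂φ̂ (Γ^M(v, w))`, where `φ̂` is the expression of `φ` in the charts
centred at `x` and at `φ x`. -/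
def secondFundamentalForm (φ : M → N) (x : M) (v w : TangentSpace (𝓡 m) x) :
    TangentSpace (𝓡 n) (φ x) :=
  let f := writtenInExtChartAt (𝓡 m) (𝓡 n) x φ
  let a := extChartAt (𝓡 m) x x
  let v' := components x x v
  let w' := components x x w
  ofComponents (φ x) (φ x)
    (fderiv ℝ (fderiv ℝ f) a v' w' +
      christoffel (φ x) (extChartAt (𝓡 n) (φ x) (φ x)) (fderiv ℝ f a v') (fderiv ℝ f a w') -
      fderiv ℝ f a (christoffel x a v' w'))

/-- The tension field `τ(φ) = trace_g ∇dφ`. -/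
def tension (φ : M → N) (x : M) : TangentSpace (𝓡 n) (φ x) :=
  metricTrace (secondFundamentalForm (m := m) (n := n) φ x)

/-- `φ` is harmonic on the open set `U`. -/
def IsHarmonicOn (φ : M → N) (U : Set M) : Prop :=
  ∀ x ∈ U, tension (m := m) (n := n) φ x = 0

/-- The smooth map `φ` is harmonic: its tension field vanishes identically. -/
def IsHarmonic (φ : M → N) : Prop :=
  ∀ x, tension (m := m) (n := n) φ x = 0

/-- `v` is an eigenvector, or zero, of `φ^*h` at `x` with eigenvalue `c`. -/
def IsEigenvectorAt (φ : M → N) (x : M) (v : TangentSpace (𝓡 m) x) (c : ℝ) : Prop :=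
  ∀ w : TangentSpace (𝓡 m) x, pullbackMetric (m := m) (n := n) φ x v w = c * inner ℝ v w

/-- `φ` is horizontally weakly conformal with dilation `dil`: at each point either `dφ = 0` (and
then the dilation is `0`), or the restriction of `dφ` to `ℋ` is surjective and conformal with
factor `dil`. -/
structure IsHorizontallyWeaklyConformal (φ : M → N) (dil : M → ℝ) : Prop where
  dil_eq_zero : ∀ x, mfderiv (𝓡 m) (𝓡 n) φ x = 0 → dil x = 0
  dil_pos : ∀ x, mfderiv (𝓡 m) (𝓡 n) φ x ≠ 0 → 0 < dil x
  surjOn : ∀ x, mfderiv (𝓡 m) (𝓡 n) φ x ≠ 0 →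
    Set.SurjOn (mfderiv (𝓡 m) (𝓡 n) φ x) (horizontal (m := m) (n := n) φ x) Set.univ
  conformal : ∀ x, mfderiv (𝓡 m) (𝓡 n) φ x ≠ 0 →
    ∀ v ∈ horizontal (m := m) (n := n) φ x, ∀ w ∈ horizontal (m := m) (n := n) φ x,
      pullbackMetric (m := m) (n := n) φ x v w = dil x ^ 2 * inner ℝ v w

/-- `(E_1, …, E_n, V_1, …, V_{m-n})` is a smooth orthonormal frame, on the set `U` of regular
points, of eigenvectors of `φ^*h`, with `E_i` horizontal for the eigenvalue `λ_i²`, `λ_i ≥ 0`, and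
`V_α` vertical (hence for the eigenvalue `0`). -/
structure IsAdaptedEigenframeOn [IsManifold (𝓡 m) ∞ M] (φ : M → N) (U : Set M)
    (E : Fin n → Π x : M, TangentSpace (𝓡 m) x)
    (V : Fin (m - n) → Π x : M, TangentSpace (𝓡 m) x)
    (lam : Fin n → M → ℝ) : Prop where
  subset_regularSet : U ⊆ regularSet (m := m) (n := n) φ
  smooth_E : ∀ i, ContMDiffOn (𝓡 m) (𝓡 m).tangent ∞
    (fun x ↦ (⟨x, E i x⟩ : TangentBundle (𝓡 m) M)) U
  smooth_V : ∀ α, ContMDiffOn (𝓡 m) (𝓡 m).tangent ∞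
    (fun x ↦ (⟨x, V α x⟩ : TangentBundle (𝓡 m) M)) U
  orthonormal : ∀ x ∈ U, Orthonormal ℝ (Sum.elim (fun i ↦ E i x) (fun α ↦ V α x))
  horizontal_E : ∀ x ∈ U, ∀ i, E i x ∈ horizontal (m := m) (n := n) φ x
  vertical_V : ∀ x ∈ U, ∀ α, V α x ∈ vertical (m := m) (n := n) φ x
  lam_nonneg : ∀ x ∈ U, ∀ i, 0 ≤ lam i x
  eigen_E : ∀ x ∈ U, ∀ i, IsEigenvectorAt (m := m) (n := n) φ x (E i x) (lam i x ^ 2)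

/-- The equations
`E_k[e(φ) - λ_k²] = ∑_i (λ_i² - λ_k²) g(∇_{E_i} E_i, E_k) - (m - n) λ_k² g(μ^𝒱, E_k)`,
`k = 1, …, n`, at the point `x`. -/
def HarmonicityEquations (φ : M → N) (E : Fin n → Π x : M, TangentSpace (𝓡 m) x)
    (lam : Fin n → M → ℝ) (x : M) : Prop :=
  ∀ k : Fin n,
    mvfderiv (𝓡 m) (fun y ↦ energyDensity (m := m) (n := n) φ y - lam k y ^ 2) x (E k x) =
      ∑ i : Fin n, (lam i x ^ 2 - lam k x ^ 2) * inner ℝ (covDeriv (E i) x (E i x)) (E k x) -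
        ((m : ℝ) - n) * lam k x ^ 2 *
          inner ℝ (meanCurvature (vertical (m := m) (n := n) φ) x) (E k x)

end Maps

end RiemMap

end

/-! ### Metrics on open subsets of a vector space -/

namespace LocalMetric

open Filter Topology ContinuousLinearMap

set_option maxSynthPendingDepth 5

variable {E : Type*} [NormedAddCommGroup E] [NormedSpace ℝ E]
  {F : Type*} [NormedAddCommGroup F] [NormedSpace ℝ F]
  {K : Type*} [NormedAddCommGroup K] [NormedSpace ℝ K]

/-! Everything rests on two facts about a map between Riemannian manifolds: `∇dφ` is symmetric, and
the derivative of `φ^*h(Y, Z)` along `X` is obtained by applying `X` to each factor, with `∇_X (dφ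
Y) = ∇dφ(X, Y) + dφ(∇_X Y)`. Since `E_i` has unit length, this gives `X(λ_i²) = 2 h(∇dφ(X, E_i), dφ
E_i)`.

For a vertical field `V`, `dφ(V) = 0` gives `∇dφ(E_i, V) = -dφ(∇_{E_i} V)`. The eigenvector equation
and `g(E_i, V) = 0` then yield `V(λ_i²) = 2 λ_i² g(∇_{E_i} E_i, V)`. Because `λ_i > 0` at regular
points, `V(ln λ_i) = g(∇_{E_i} E_i, V)`; the sum over `i` is `n g(μ^ℋ, V)`, which proves the first
claim. In the horizontally conformal case all `λ_i` equal the dilation.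

For harmonicity, `dφ E_1, …, dφ E_n` span the tangent space of `N`, so `τ(φ) = 0` can be tested
against each `dφ E_k`. For `i ≠ k`, differentiating `φ^*h(E_i, E_k) = 0` along `E_i` expresses
`h(∇dφ(E_i, E_i), dφ E_k)` through `g(∇_{E_i} E_i, E_k)` and `E_k(λ_i²)`. The term `i = k` is half
of `E_k(λ_k²)`, and the vertical terms give `-λ_k² g(∇_{V_α} V_α, E_k)`. With `e(φ) = ½ ∑ λ_i²`, the
sum is the difference of the two sides of the stated equation.

The calculus is done for metrics on a vector space (`hess`, `nabla`) and transported by charts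
(`isMetricAt_chartMetric`, `covDeriv_eq_nabla`, `tension_eq`). The pointwise statements are
`mvfderiv_log_lam` and `tension_eq_zero_iff`. Passing from a dense set to `M` needs continuity of
the tension field (`isHarmonic_of_dense`); the definition uses charts centred at the moving point,
so this requires independence of charts. That follows because a change of charts is an isometry,
hence has zero second fundamental form. -/

/-- `G` is a smooth family of nondegenerate symmetric bilinear forms near `a`. -/
structure IsMetricAt (G : E → E →L[ℝ] E →L[ℝ] ℝ) (a : E) : Prop where
  contDiffAt : ContDiffAt ℝ ∞ G a
  symm : ∀ᶠ y in 𝓝 a, ∀ v w, G y v w = G y w v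
  isInvertible : (G a).IsInvertible

/-- Christoffel symbols of the first kind. -/
noncomputable def christoffelOne (G : E → E →L[ℝ] E →L[ℝ] ℝ) (y v w : E) : E →L[ℝ] ℝ :=
  (1 / 2 : ℝ) • (fderiv ℝ G y v w + fderiv ℝ G y w v - ((fderiv ℝ G y).flip v).flip w)

/-- Christoffel symbols of the second kind. -/
noncomputable def christoffelTwo (G : E → E →L[ℝ] E →L[ℝ] ℝ) (y v w : E) : E :=
  (G y).inverse (christoffelOne G y v w)

/-- The covariant derivative of the vector field `Y` in the direction `v`. -/
noncomputable def nabla (G : E → E →L[ℝ] E →L[ℝ] ℝ) (Y : E → E) (y v : E) : E :=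
  fderiv ℝ Y y v + christoffelTwo G y v (Y y)

/-- The second fundamental form of a map `f`. -/
noncomputable def hess (G : E → E →L[ℝ] E →L[ℝ] ℝ) (H : F → F →L[ℝ] F →L[ℝ] ℝ) (f : E → F)
    (y v w : E) : F :=
  fderiv ℝ (fderiv ℝ f) y v w + christoffelTwo H (f y) (fderiv ℝ f y v) (fderiv ℝ f y w) -
    fderiv ℝ f y (christoffelTwo G y v w)

variable {G : E → E →L[ℝ] E →L[ℝ] ℝ} {H : F → F →L[ℝ] F →L[ℝ] ℝ} {f : E → F} {a : E}

namespace IsMetricAt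

theorem differentiableAt (hG : IsMetricAt G a) : DifferentiableAt ℝ G a :=
  hG.contDiffAt.differentiableAt (by simp)

theorem symm_self (hG : IsMetricAt G a) (v w : E) : G a v w = G a w v :=
  hG.symm.self_of_nhds v w

/-- Symmetry holds in a neighbourhood, so it passes to the derivative. -/
theorem fderiv_symm (hG : IsMetricAt G a) (u v w : E) :
    fderiv ℝ G a u v w = fderiv ℝ G a u w v := by
  have h1 : ∀ v w, fderiv ℝ G a u v w = fderiv ℝ (fun y ↦ G y v w) a u := fun v w ↦ by
    rw [((hG.differentiableAt.hasFDerivAt.clm_apply (hasFDerivAt_const v a)).clm_apply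
      (hasFDerivAt_const w a)).fderiv]
    simp
  rw [h1, h1]
  congr 1
  exact EventuallyEq.fderiv_eq (hG.symm.mono fun y hy ↦ hy v w)

theorem ext_left (hG : IsMetricAt G a) {u v : E} (h : ∀ w, G a u w = G a v w) : u = v :=
  hG.isInvertible.injective (by ext w; exact h w)

/-- Lowering the index again undoes `inverse`. The identities for the connection below all reduce to
this Koszul formula for constant fields, by nondegeneracy. -/
theorem apply_christoffelTwo (hG : IsMetricAt G a) (v w z : E) :
    G a (christoffelTwo G a v w) z =
      (1 / 2 : ℝ) * (fderiv ℝ G a v w z + fderiv ℝ G a w v z - fderiv ℝ G a z v w) := by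
  rw [christoffelTwo, hG.isInvertible.self_apply_inverse]
  simp [christoffelOne]

/-- The connection is torsion-free: the Koszul formula is symmetric in its first two arguments. -/
theorem christoffelTwo_comm (hG : IsMetricAt G a) (v w : E) :
    christoffelTwo G a v w = christoffelTwo G a w v := by
  refine hG.ext_left fun z ↦ ?_
  rw [hG.apply_christoffelTwo, hG.apply_christoffelTwo, hG.fderiv_symm z v w]
  ring

/-- This is compatibility with the metric for constant fields: of the six Koszul terms, four cancel
and the other two add up. -/
theorem fderiv_apply_apply (hG : IsMetricAt G a) (u v w : E) :
    fderiv ℝ G a u v w =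
      G a (christoffelTwo G a u v) w + G a v (christoffelTwo G a u w) := by
  rw [hG.symm_self v, hG.apply_christoffelTwo, hG.apply_christoffelTwo,
    hG.fderiv_symm u w v, hG.fderiv_symm w u v, hG.fderiv_symm v u w]
  ring

/-- The Levi-Civita connection is compatible with the metric. -/
theorem fderiv_metric (hG : IsMetricAt G a) {Y Z : E → E} (hY : DifferentiableAt ℝ Y a)
    (hZ : DifferentiableAt ℝ Z a) (v : E) :
    fderiv ℝ (fun y ↦ G y (Y y) (Z y)) a v =
      G a (nabla G Y a v) (Z a) + G a (Y a) (nabla G Z a v) := by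
  rw [((hG.differentiableAt.hasFDerivAt.clm_apply hY.hasFDerivAt).clm_apply hZ.hasFDerivAt).fderiv]
  simp [nabla, hG.fderiv_apply_apply]
  ring

end IsMetricAt

/-- Invertibility of `G y` plays no role in these bilinearity rules, since `inverse` is a linear map
in every case. -/
theorem christoffelTwo_add_left (y u v w : E) :
    christoffelTwo G y (u + v) w = christoffelTwo G y u w + christoffelTwo G y v w := by
  rw [christoffelTwo, christoffelTwo, christoffelTwo, ← map_add]
  congr 1; ext z; simp [christoffelOne]; ring

theorem christoffelTwo_smul_left (y : E) (c : ℝ) (v w : E) :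
    christoffelTwo G y (c • v) w = c • christoffelTwo G y v w := by
  rw [christoffelTwo, christoffelTwo, ← map_smul]
  congr 1; ext z; simp [christoffelOne]; ring

theorem christoffelTwo_add_right (y u v w : E) :
    christoffelTwo G y u (v + w) = christoffelTwo G y u v + christoffelTwo G y u w := by
  rw [christoffelTwo, christoffelTwo, christoffelTwo, ← map_add]
  congr 1; ext z; simp [christoffelOne]; ring

theorem christoffelTwo_smul_right (y : E) (c : ℝ) (v w : E) :
    christoffelTwo G y v (c • w) = c • christoffelTwo G y v w := by
  rw [christoffelTwo, christoffelTwo, ← map_smul]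
  congr 1; ext z; simp [christoffelOne]; ring

theorem nabla_add_dir (Y : E → E) (y u v : E) :
    nabla G Y y (u + v) = nabla G Y y u + nabla G Y y v := by
  simp only [nabla, map_add, christoffelTwo_add_left]; abel

theorem nabla_smul_dir (Y : E → E) (y : E) (c : ℝ) (v : E) :
    nabla G Y y (c • v) = c • nabla G Y y v := by
  simp only [nabla, map_smul, christoffelTwo_smul_left, smul_add]

/-- The second fundamental form as a bilinear map. -/
noncomputable def hessLin (G : E → E →L[ℝ] E →L[ℝ] ℝ) (H : F → F →L[ℝ] F →L[ℝ] ℝ) (f : E → F)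
    (y : E) : E →ₗ[ℝ] E →ₗ[ℝ] F := by
  refine LinearMap.mk₂ ℝ (hess G H f y) (fun u v w ↦ ?_) (fun c v w ↦ ?_) (fun u v w ↦ ?_)
    (fun c v w ↦ ?_)
  · simp only [hess, map_add, christoffelTwo_add_left, add_apply]
    abel
  · simp only [hess, map_smul, christoffelTwo_smul_left, smul_apply, smul_sub, smul_add]
  · simp only [hess, map_add, christoffelTwo_add_right]
    abel
  · simp only [hess, map_smul, christoffelTwo_smul_right, smul_sub, smul_add]

@[simp] theorem hessLin_apply (y v w : E) : hessLin G H f y v w = hess G H f y v w := rfl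

/-- Symmetry of second derivatives takes care of the first term, and absence of torsion on both
sides of the other two. -/
theorem hess_comm (hG : IsMetricAt G a) (hH : IsMetricAt H (f a)) (hf : ContDiffAt ℝ ∞ f a)
    (v w : E) : hess G H f a v w = hess G H f a w v := by
  rw [hess, hess, hH.christoffelTwo_comm, hG.christoffelTwo_comm,
    (hf.isSymmSndFDerivAt (by simpa [minSmoothness_of_isRCLikeNormedField] using ENat.LEInfty.out)).eq v w]

theorem differentiableAt_fderiv (hf : ContDiffAt ℝ ∞ f a) : DifferentiableAt ℝ (fderiv ℝ f) a :=
  (hf.fderiv_right (m := 1) (by norm_cast)).differentiableAt (by simp)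

theorem fderiv_fderiv_apply (hf : ContDiffAt ℝ ∞ f a) {Y : E → E} (hY : DifferentiableAt ℝ Y a)
    (v : E) : fderiv ℝ (fun y ↦ fderiv ℝ f y (Y y)) a v =
      fderiv ℝ (fderiv ℝ f) a v (Y a) + fderiv ℝ f a (fderiv ℝ Y a v) := by
  rw [((differentiableAt_fderiv hf).hasFDerivAt.clm_apply hY.hasFDerivAt).fderiv]
  simp [add_comm]

/-- The covariant derivative along `f` of the image of a vector field. -/
theorem fderiv_image_field (hf : ContDiffAt ℝ ∞ f a) {Y : E → E} (hY : DifferentiableAt ℝ Y a)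
    (v : E) : fderiv ℝ (fun y ↦ fderiv ℝ f y (Y y)) a v +
        christoffelTwo H (f a) (fderiv ℝ f a v) (fderiv ℝ f a (Y a)) =
      hess G H f a v (Y a) + fderiv ℝ f a (nabla G Y a v) := by
  rw [fderiv_fderiv_apply hf hY, hess, nabla, map_add]
  abel

/-- If `df(Y)` vanishes near `a`, then `∇df(v, Y) = - df(∇_v Y)`. -/
theorem hess_eq_neg_of_fderiv_eq_zero (hf : ContDiffAt ℝ ∞ f a) {Y : E → E}
    (hY : DifferentiableAt ℝ Y a) (h0 : ∀ᶠ y in 𝓝 a, fderiv ℝ f y (Y y) = 0) (v : E) :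
    hess G H f a v (Y a) = - fderiv ℝ f a (nabla G Y a v) := by
  have h := fderiv_image_field (G := G) (H := H) hf hY v
  have h1 : fderiv ℝ (fun y ↦ fderiv ℝ f y (Y y)) a = 0 := by
    rw [EventuallyEq.fderiv_eq (f := fun _ ↦ (0 : F)) h0]; simp
  -- Writing the zero vector as `0 • 0` lets homogeneity remove the Christoffel term.
  rw [h1, h0.self_of_nhds, ← zero_smul ℝ (0 : F), christoffelTwo_smul_right] at h
  rw [eq_neg_iff_add_eq_zero, ← h]
  simp

/-- The derivative of the first fundamental form. -/
theorem fderiv_pullback (hH : IsMetricAt H (f a)) (hf : ContDiffAt ℝ ∞ f a)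
    {Y Z : E → E} (hY : DifferentiableAt ℝ Y a) (hZ : DifferentiableAt ℝ Z a) (v : E) :
    fderiv ℝ (fun y ↦ H (f y) (fderiv ℝ f y (Y y)) (fderiv ℝ f y (Z y))) a v =
      H (f a) (hess G H f a v (Y a) + fderiv ℝ f a (nabla G Y a v)) (fderiv ℝ f a (Z a)) +
      H (f a) (fderiv ℝ f a (Y a)) (hess G H f a v (Z a) + fderiv ℝ f a (nabla G Z a v)) := by
  have hfd := hf.differentiableAt (by simp)
  have hY' : DifferentiableAt ℝ (fun y ↦ fderiv ℝ f y (Y y)) a :=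
    (differentiableAt_fderiv hf).clm_apply hY
  have hZ' : DifferentiableAt ℝ (fun y ↦ fderiv ℝ f y (Z y)) a :=
    (differentiableAt_fderiv hf).clm_apply hZ
  rw [← fderiv_image_field (G := G) (H := H) hf hY, ← fderiv_image_field (G := G) (H := H) hf hZ]
  have hc : HasFDerivAt (fun y ↦ H (f y)) ((fderiv ℝ H (f a)).comp (fderiv ℝ f a)) a :=
    HasFDerivAt.comp (g := H) a hH.differentiableAt.hasFDerivAt hfd.hasFDerivAt
  rw [((hc.clm_apply hY'.hasFDerivAt).clm_apply hZ'.hasFDerivAt).fderiv]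
  simp [hH.fderiv_apply_apply]
  ring

/-- The second fundamental form of a local isometry vanishes. -/
theorem hess_eq_zero_of_isometry {H : F → F →L[ℝ] F →L[ℝ] ℝ} (hG : IsMetricAt G a)
    (hH : IsMetricAt H (f a)) (hf : ContDiffAt ℝ ∞ f a)
    (hs : Function.Surjective (fderiv ℝ f a))
    (hiso : ∀ᶠ y in 𝓝 a, ∀ v w, H (f y) (fderiv ℝ f y v) (fderiv ℝ f y w) = G y v w) (v w : E) :
    hess G H f a v w = 0 := by
  -- Differentiate the isometry relation along `u` for constant fields `v` and `w`. The covariant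
  -- derivatives of `v` and `w` contribute equally to both sides and cancel.
  have key : ∀ u v w, H (f a) (hess G H f a u v) (fderiv ℝ f a w) +
      H (f a) (hess G H f a u w) (fderiv ℝ f a v) = 0 := fun u v w ↦ by
    have h1 := fderiv_pullback (G := G) hH hf (differentiableAt_const v)
      (differentiableAt_const w) u
    have h2 := hG.fderiv_metric (differentiableAt_const v) (differentiableAt_const w) u
    rw [EventuallyEq.fderiv_eq (hiso.mono fun y hy ↦ hy v w), h2,
      ← hiso.self_of_nhds, ← hiso.self_of_nhds] at h1
    rw [hH.symm_self (hess G H f a u w)]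
    simp only [map_add, add_apply] at h1
    linarith
  have hc := hess_comm hG hH hf
  refine hH.ext_left fun z ↦ ?_
  obtain ⟨z, rfl⟩ := hs z
  -- The trilinear form `H(∇df(u, v), df w)` is symmetric in `u, v` and, by `key`, antisymmetric in
  -- `v, w`; such a form vanishes. Surjectivity of the differential then gives `∇df = 0`.
  have h1 := key v w z
  have h2 := key w z v
  have h3 := key z v w
  rw [hc w z, hc w v] at h2
  rw [hc z v] at h3
  simp only [map_zero, zero_apply]
  linarith

/-- The second fundamental form of a composition. -/
theorem hess_comp {P : K → K →L[ℝ] K →L[ℝ] ℝ} {g : F → K} (hf : ContDiffAt ℝ ∞ f a)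
    (hg : ContDiffAt ℝ ∞ g (f a)) (v w : E) :
    hess G P (g ∘ f) a v w =
      hess H P g (f a) (fderiv ℝ f a v) (fderiv ℝ f a w) + fderiv ℝ g (f a) (hess G H f a v w) := by
  have hfd := hf.differentiableAt (by simp)
  have hgd := hg.differentiableAt (by simp)
  have h1 : fderiv ℝ (g ∘ f) =ᶠ[𝓝 a] fun y ↦ (fderiv ℝ g (f y)).comp (fderiv ℝ f y) := by
    have hgn := (hg.of_le (m := 1) (by norm_cast)).eventually (by simp)
    have hfn := (hf.of_le (m := 1) (by norm_cast)).eventually (by simp)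
    filter_upwards [hf.continuousAt.eventually hgn, hfn] with y hy hy'
    exact fderiv_comp y (hy.differentiableAt (by simp)) (hy'.differentiableAt (by simp))
  have h2 : HasFDerivAt (fun y ↦ fderiv ℝ g (f y))
      ((fderiv ℝ (fderiv ℝ g) (f a)).comp (fderiv ℝ f a)) a :=
    (differentiableAt_fderiv hg).hasFDerivAt.comp a hfd.hasFDerivAt
  have h3 := (h2.clm_comp (differentiableAt_fderiv hf).hasFDerivAt)
  simp only [hess, h1.fderiv_eq, h3.fderiv, h1.self_of_nhds]
  simp
  abel

end LocalMetric

namespace LocalMetric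

open Filter Topology ContinuousLinearMap

set_option synthInstance.maxHeartbeats 200000
set_option maxSynthPendingDepth 5

/-! ### Traces of bilinear maps in orthonormal families -/

section Trace

variable {V : Type*} [NormedAddCommGroup V] [InnerProductSpace ℝ V]
  {W : Type*} [AddCommGroup W] [Module ℝ W] {ι κ : Type*} [Fintype ι] [Fintype κ]

/-- The trace of a bilinear map does not depend on the orthonormal basis: two families which
expand each other orthonormally give the same trace. -/
theorem sum_apply_self_eq_of_expansion (B : V →ₗ[ℝ] V →ₗ[ℝ] W) {b : ι → V} {b' : κ → V}
    (h : ∀ i, b i = ∑ j, inner ℝ (b' j) (b i) • b' j)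
    (h' : ∀ j, b' j = ∑ i, inner ℝ (b i) (b' j) • b i) :
    ∑ i, B (b i) (b i) = ∑ j, B (b' j) (b' j) := by
  -- Both sums expand to the same double sum of `⟨b' j, b i⟩ • B (b' j) (b i)`. Neither family needs
  -- to span `V`, so the result also serves for bases of a subspace.
  have h1 : ∀ i, B (b i) (b i) = ∑ j, inner ℝ (b' j) (b i) • B (b' j) (b i) := fun i ↦ by
    conv_lhs => rw [show B (b i) = ∑ j, inner ℝ (b' j) (b i) • B (b' j) by
      conv_lhs => rw [h i]
      simp]
    simp [LinearMap.sum_apply]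
  have h2 : ∀ j, B (b' j) (b' j) = ∑ i, inner ℝ (b i) (b' j) • B (b' j) (b i) := fun j ↦ by
    conv_lhs => enter [2]; rw [h' j]
    simp
  simp_rw [h1, h2]
  rw [Finset.sum_comm]
  simp_rw [real_inner_comm]

end Trace

/-! ### Eigenfields of the first fundamental form -/

variable {E : Type*} [NormedAddCommGroup E] [NormedSpace ℝ E]
  {F : Type*} [NormedAddCommGroup F] [NormedSpace ℝ F]
  {G : E → E →L[ℝ] E →L[ℝ] ℝ} {H : F → F →L[ℝ] F →L[ℝ] ℝ} {f : E → F} {a : E}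

/-- Metric compatibility applied to a constant inner product: a derivative can be moved from one
field to the other at the cost of a sign. -/
theorem IsMetricAt.nabla_left_eq_neg (hG : IsMetricAt G a) {Y Z : E → E}
    (hY : DifferentiableAt ℝ Y a) (hZ : DifferentiableAt ℝ Z a) {c : ℝ}
    (hc : ∀ᶠ y in 𝓝 a, G y (Y y) (Z y) = c) (v : E) :
    G a (nabla G Y a v) (Z a) = - G a (Y a) (nabla G Z a v) := by
  have h := hG.fderiv_metric hY hZ v
  rw [EventuallyEq.fderiv_eq (f := fun _ ↦ c) hc] at h
  simp only [fderiv_fun_const, Pi.zero_apply, zero_apply] at h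
  linarith

/-- `Y` is near `a` a unit field of eigenvectors, with eigenvalue `l`, of the pullback of `H`. -/
structure IsEigenfield (G : E → E →L[ℝ] E →L[ℝ] ℝ) (H : F → F →L[ℝ] F →L[ℝ] ℝ) (f : E → F)
    (Y : E → E) (l : E → ℝ) (a : E) : Prop where
  differentiableAt : DifferentiableAt ℝ Y a
  unit : ∀ᶠ y in 𝓝 a, G y (Y y) (Y y) = 1
  eigen : ∀ᶠ y in 𝓝 a, ∀ w, H (f y) (fderiv ℝ f y (Y y)) (fderiv ℝ f y w) = l y * G y (Y y) w

namespace IsEigenfield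

variable {Y Z : E → E} {l r : E → ℝ}

/-- No regularity is assumed of the eigenvalue; its differentiability and its derivative both come
from this expression. -/
theorem eigenvalue_eq (hY : IsEigenfield G H f Y l a) :
    l =ᶠ[𝓝 a] fun y ↦ H (f y) (fderiv ℝ f y (Y y)) (fderiv ℝ f y (Y y)) := by
  filter_upwards [hY.unit, hY.eigen] with y h1 h2
  rw [h2, h1, mul_one]

theorem differentiableAt_eigenvalue (hH : IsMetricAt H (f a)) (hf : ContDiffAt ℝ ∞ f a)
    (hY : IsEigenfield G H f Y l a) : DifferentiableAt ℝ l a := by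
  refine DifferentiableAt.congr_of_eventuallyEq ?_ hY.eigenvalue_eq
  have h1 := (differentiableAt_fderiv hf).clm_apply hY.differentiableAt
  have h2 : DifferentiableAt ℝ (fun y ↦ H (f y)) a :=
    DifferentiableAt.comp (g := H) a hH.differentiableAt (hf.differentiableAt (by simp))
  exact (h2.clm_apply h1).clm_apply h1

/-- The terms containing `∇_v Y` are multiples of `G(∇_v Y, Y)`, which is zero because `Y` has unit
length. -/
theorem fderiv_eigenvalue (hG : IsMetricAt G a) (hH : IsMetricAt H (f a))
    (hf : ContDiffAt ℝ ∞ f a) (hY : IsEigenfield G H f Y l a) (v : E) :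
    fderiv ℝ l a v = 2 * H (f a) (hess G H f a v (Y a)) (fderiv ℝ f a (Y a)) := by
  rw [hY.eigenvalue_eq.fderiv_eq,
    fderiv_pullback (G := G) hH hf hY.differentiableAt hY.differentiableAt,
    hH.symm_self (fderiv ℝ f a (Y a)), map_add, add_apply,
    hH.symm_self (fderiv ℝ f a (nabla G Y a v)), hY.eigen.self_of_nhds]
  have h1 := hG.nabla_left_eq_neg hY.differentiableAt hY.differentiableAt hY.unit v
  rw [hG.symm_self] at h1
  have h2 : G a (Y a) (nabla G Y a v) = 0 := by linarith
  rw [h2]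
  ring

/-- The derivative of an eigenvalue in the direction of the kernel of `df`. -/
theorem fderiv_eigenvalue_vertical (hG : IsMetricAt G a) (hH : IsMetricAt H (f a))
    (hf : ContDiffAt ℝ ∞ f a) (hY : IsEigenfield G H f Y l a) (hZ : DifferentiableAt ℝ Z a)
    (hker : ∀ᶠ y in 𝓝 a, fderiv ℝ f y (Z y) = 0) (horth : ∀ᶠ y in 𝓝 a, G y (Y y) (Z y) = 0) :
    fderiv ℝ l a (Z a) = 2 * l a * G a (nabla G Y a (Y a)) (Z a) := by
  rw [hY.fderiv_eigenvalue hG hH hf, hess_comm hG hH hf,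
    hess_eq_neg_of_fderiv_eq_zero hf hZ hker, map_neg, neg_apply,
    hH.symm_self, hY.eigen.self_of_nhds,
    hG.nabla_left_eq_neg hY.differentiableAt hZ horth]
  ring

/-- A vertical field satisfies `∇df(Z, Z) = -df(∇_Z Z)`, and the eigenvector equation for `Y`
evaluates the pairing with `df Y`. -/
theorem metric_hess_vertical (hG : IsMetricAt G a) (hH : IsMetricAt H (f a))
    (hf : ContDiffAt ℝ ∞ f a) (hY : IsEigenfield G H f Y l a) (hZ : DifferentiableAt ℝ Z a)
    (hker : ∀ᶠ y in 𝓝 a, fderiv ℝ f y (Z y) = 0) :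
    H (f a) (hess G H f a (Z a) (Z a)) (fderiv ℝ f a (Y a)) =
      - (l a * G a (nabla G Z a (Z a)) (Y a)) := by
  rw [hess_eq_neg_of_fderiv_eq_zero hf hZ hker, map_neg, neg_apply, hH.symm_self,
    hY.eigen.self_of_nhds, hG.symm_self]

theorem metric_hess_self (hG : IsMetricAt G a) (hH : IsMetricAt H (f a))
    (hf : ContDiffAt ℝ ∞ f a) (hY : IsEigenfield G H f Y l a) :
    H (f a) (hess G H f a (Y a) (Y a)) (fderiv ℝ f a (Y a)) = 1 / 2 * fderiv ℝ l a (Y a) := by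
  rw [hY.fderiv_eigenvalue hG hH hf]
  ring

/-- Eigenfields that are orthogonal for `G` have orthogonal images; differentiate this relation
along `Y`. The term `H(df Y, ∇df(Y, Z))` becomes half the derivative of `l` along `Z` by symmetry of
`∇df`, and the two connection terms combine because `G(Y, Z)` is constant. -/
theorem metric_hess_orthogonal (hG : IsMetricAt G a) (hH : IsMetricAt H (f a))
    (hf : ContDiffAt ℝ ∞ f a) (hY : IsEigenfield G H f Y l a) (hZ : IsEigenfield G H f Z r a)
    (horth : ∀ᶠ y in 𝓝 a, G y (Y y) (Z y) = 0) :
    H (f a) (hess G H f a (Y a) (Y a)) (fderiv ℝ f a (Z a)) =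
      (l a - r a) * G a (nabla G Y a (Y a)) (Z a) - 1 / 2 * fderiv ℝ l a (Z a) := by
  have h0 : ∀ᶠ y in 𝓝 a, H (f y) (fderiv ℝ f y (Y y)) (fderiv ℝ f y (Z y)) = 0 := by
    filter_upwards [hY.eigen, horth] with y h1 h2
    rw [h1, h2, mul_zero]
  have h1 := fderiv_pullback (G := G) hH hf hY.differentiableAt hZ.differentiableAt (Y a)
  rw [EventuallyEq.fderiv_eq (f := fun _ ↦ (0 : ℝ)) h0] at h1
  simp only [fderiv_fun_const, Pi.zero_apply, zero_apply, map_add, add_apply] at h1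
  rw [hH.symm_self (fderiv ℝ f a (nabla G Y a (Y a))), hZ.eigen.self_of_nhds,
    hY.eigen.self_of_nhds, hH.symm_self (fderiv ℝ f a (Y a)), hess_comm hG hH hf (Y a) (Z a),
    hG.symm_self (Z a)] at h1
  have h2 := hG.nabla_left_eq_neg hY.differentiableAt hZ.differentiableAt horth (Y a)
  have h3 := hY.fderiv_eigenvalue hG hH hf (Z a)
  linear_combination -h1 - l a * h2 + 1 / 2 * h3

end IsEigenfield

/-! ### The trace of the second fundamental form in a fixed basis -/

theorem hess_congr {g : E → F} (h : f =ᶠ[𝓝 a] g) (v w : E) :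
    hess G H f a v w = hess G H g a v w := by
  rw [hess, hess, h.fderiv.fderiv_eq, h.fderiv_eq, h.self_of_nhds]

/-- The trace of `hess`, computed with the inverse of the metric in the basis `s`. -/
noncomputable def laplace {ι : Type*} [Fintype ι] [FiniteDimensional ℝ E] (s : Module.Basis ι ℝ E)
    (G : E → E →L[ℝ] E →L[ℝ] ℝ) (H : F → F →L[ℝ] F →L[ℝ] ℝ) (f : E → F) (y : E) : F :=
  ∑ j, hess G H f y ((G y).inverse (s.coord j).toContinuousLinearMap) (s j)

/-- Raising the index of the coordinate form of `s j` gives `∑ i, s.coord j (b i) • b i`, by the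
expansion `hb`; expanding each `b i` in `s` then gives the same double sum. -/
theorem laplace_eq_sum {ι κ : Type*} [Fintype ι] [Fintype κ] [FiniteDimensional ℝ E]
    (s : Module.Basis ι ℝ E) (hG : IsMetricAt G a) {b : κ → E}
    (hb : ∀ w, w = ∑ i, G a (b i) w • b i) :
    laplace s G H f a = ∑ i, hess G H f a (b i) (b i) := by
  have h1 : ∀ i, hess G H f a (b i) (b i) = ∑ j, s.coord j (b i) • hess G H f a (b i) (s j) :=
    fun i ↦ by
    conv_lhs => rw [← hessLin_apply]; enter [2]; rw [← s.sum_repr (b i)]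
    rw [map_sum]
    simp
  simp_rw [h1, laplace]
  rw [Finset.sum_comm]
  refine Finset.sum_congr rfl fun j _ ↦ ?_
  have h2 : (G a).inverse (s.coord j).toContinuousLinearMap = ∑ i, s.coord j (b i) • b i := by
    rw [hG.isInvertible.inverse_apply_eq]
    ext w
    conv_lhs => rw [hb w]
    simp only [map_sum, map_smul, sum_apply, smul_apply, smul_eq_mul]
    refine Finset.sum_congr rfl fun i _ ↦ ?_
    simp [mul_comm]
  rw [h2, ← hessLin_apply]
  simp

/-! ### Continuity of the trace -/

section Continuity

variable [CompleteSpace E] [CompleteSpace F] {X : Type*} [TopologicalSpace X] {x : X}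

theorem IsMetricAt.continuousAt_inverse (hG : IsMetricAt G a) :
    ContinuousAt (fun y ↦ (G y).inverse) a :=
  ContinuousAt.comp (g := ContinuousLinearMap.inverse)
    (hG.isInvertible.contDiffAt_map_inverse (n := 0)).continuousAt hG.contDiffAt.continuousAt

theorem IsMetricAt.continuousAt_christoffelTwo (hG : IsMetricAt G a) {p v w : X → E}
    (hp : ContinuousAt p x) (hpx : p x = a) (hv : ContinuousAt v x) (hw : ContinuousAt w x) :
    ContinuousAt (fun q ↦ christoffelTwo G (p q) (v q) (w q)) x := by
  subst hpx
  have hD : ContinuousAt (fun q ↦ fderiv ℝ G (p q)) x :=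
    ContinuousAt.comp (g := fderiv ℝ G) (f := p)
      (hG.contDiffAt.fderiv_right (m := 0) (by simp)).continuousAt hp
  have hI : ContinuousAt (fun q ↦ (G (p q)).inverse) x :=
    ContinuousAt.comp (g := fun y ↦ (G y).inverse) (f := p) hG.continuousAt_inverse hp
  have hF : ContinuousAt (fun q ↦ ((fderiv ℝ G (p q)).flip (v q)).flip (w q)) x := by
    have h1 : ContinuousAt (fun q ↦ (fderiv ℝ G (p q)).flip) x :=
      (ContinuousLinearMap.flipₗᵢ ℝ E E (E →L[ℝ] ℝ)).continuous.continuousAt.comp hD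
    have h2 := h1.clm_apply hv
    have h3 : ContinuousAt (fun q ↦ ((fderiv ℝ G (p q)).flip (v q)).flip) x :=
      (ContinuousLinearMap.flipₗᵢ ℝ E E ℝ).continuous.continuousAt.comp h2
    exact h3.clm_apply hw
  have hO : ContinuousAt (fun q ↦ christoffelOne G (p q) (v q) (w q)) x :=
    ((((hD.clm_apply hv).clm_apply hw).add ((hD.clm_apply hw).clm_apply hv)).sub hF).const_smul
      (1 / 2 : ℝ)
  exact hI.clm_apply hO

/-- The orthonormal bases chosen at different points need not vary continuously. The trace written
with a fixed basis and the inverse metric does, which is what the density argument needs. -/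
theorem continuousAt_laplace {ι : Type*} [Fintype ι] [FiniteDimensional ℝ E]
    (s : Module.Basis ι ℝ E) (hG : IsMetricAt G a) (hH : IsMetricAt H (f a))
    (hf : ContDiffAt ℝ ∞ f a) : ContinuousAt (laplace s G H f) a := by
  refine tendsto_finsetSum _ fun j _ ↦ ?_
  have hv : ContinuousAt (fun y ↦ (G y).inverse (s.coord j).toContinuousLinearMap) a :=
    hG.continuousAt_inverse.clm_apply continuousAt_const
  have hf1 : ContinuousAt (fderiv ℝ f) a := (differentiableAt_fderiv hf).continuousAt
  have hf2 : ContinuousAt (fderiv ℝ (fderiv ℝ f)) a :=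
    ((hf.fderiv_right (m := ∞) (by simp)).fderiv_right (m := 0) (by simp)).continuousAt
  exact (((hf2.clm_apply hv).clm_apply continuousAt_const).add
    (hH.continuousAt_christoffelTwo hf.continuousAt rfl (hf1.clm_apply hv)
      (hf1.clm_apply continuousAt_const))).sub
    (hf1.clm_apply (hG.continuousAt_christoffelTwo continuousAt_id rfl hv continuousAt_const))

end Continuity

end LocalMetric

namespace RiemMap

open Filter Topology LocalMetric

set_option maxSynthPendingDepth 5

/-! ### Reading tangent vectors, fields and the metric in a chart -/

section Chart

variable {m : ℕ} {M : Type*} [TopologicalSpace M] [ChartedSpace (EuclideanSpace ℝ (Fin m)) M]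

theorem target_mem_nhds {c : M} {y : EuclideanSpace ℝ (Fin m)}
    (hy : y ∈ (extChartAt (𝓡 m) c).target) : (extChartAt (𝓡 m) c).target ∈ 𝓝 y :=
  (isOpen_extChartAt_target c).mem_nhds hy

theorem chartField_extChartAt {c p : M} (hp : p ∈ (extChartAt (𝓡 m) c).source)
    (Y : Π p : M, TangentSpace (𝓡 m) p) :
    chartField c Y (extChartAt (𝓡 m) c p) = components c p (Y p) :=
  congrArg (fun q ↦ components c q (Y q)) ((extChartAt (𝓡 m) c).left_inv hp)

theorem chartMetric_apply [RiemannianBundle (fun x : M ↦ TangentSpace (𝓡 m) x)]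
    (c : M) (y v w : EuclideanSpace ℝ (Fin m)) :
    chartMetric c y v w = inner ℝ (fromChart c y v) (fromChart c y w) := rfl

variable [IsManifold (𝓡 m) ∞ M]

theorem isManifold_one : IsManifold (𝓡 m) 1 M := IsManifold.of_le (n := ∞) (by simp)

theorem components_fromChart {c : M} {y : EuclideanSpace ℝ (Fin m)}
    (hy : y ∈ (extChartAt (𝓡 m) c).target) (v : EuclideanSpace ℝ (Fin m)) :
    components c ((extChartAt (𝓡 m) c).symm y) (fromChart c y v) = v := by
  have := isManifold_one (m := m) (M := M)
  have h := mfderiv_extChartAt_comp_mfderivWithin_extChartAt_symm (I := 𝓡 m) hy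
  -- The model has no boundary, so derivatives within its range are ordinary derivatives.
  have hr : Set.range (𝓡 m) = Set.univ := by simp
  rw [hr, mfderivWithin_univ] at h
  exact DFunLike.congr_fun h v

theorem fromChart_components {c : M} {y : EuclideanSpace ℝ (Fin m)}
    (hy : y ∈ (extChartAt (𝓡 m) c).target)
    (v : TangentSpace (𝓡 m) ((extChartAt (𝓡 m) c).symm y)) :
    fromChart c y (components c ((extChartAt (𝓡 m) c).symm y) v) = v := by
  have := isManifold_one (m := m) (M := M)
  have h := mfderivWithin_extChartAt_symm_comp_mfderiv_extChartAt (I := 𝓡 m) hy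
  have hr : Set.range (𝓡 m) = Set.univ := by simp
  rw [hr, mfderivWithin_univ] at h
  exact DFunLike.congr_fun h v

theorem ofComponents_components {c p : M} (hp : p ∈ (extChartAt (𝓡 m) c).source)
    (v : TangentSpace (𝓡 m) p) : ofComponents c p (components c p v) = v := by
  have := isManifold_one (m := m) (M := M)
  have h := mfderivWithin_extChartAt_symm_comp_mfderiv_extChartAt' (I := 𝓡 m) hp
  have hr : Set.range (𝓡 m) = Set.univ := by simp
  rw [hr, mfderivWithin_univ] at h
  exact DFunLike.congr_fun h v

theorem components_ofComponents {c p : M} (hp : p ∈ (extChartAt (𝓡 m) c).source)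
    (v : EuclideanSpace ℝ (Fin m)) : components c p (ofComponents c p v) = v := by
  have := isManifold_one (m := m) (M := M)
  have h := mfderiv_extChartAt_comp_mfderivWithin_extChartAt_symm' (I := 𝓡 m) hp
  have hr : Set.range (𝓡 m) = Set.univ := by simp
  rw [hr, mfderivWithin_univ] at h
  exact DFunLike.congr_fun h v

/-- The field in coordinates is the fibre component of the tangent map of the chart, composed with
the section and with the inverse chart. -/
theorem contDiffAt_chartField {c : M} {y : EuclideanSpace ℝ (Fin m)}
    (hy : y ∈ (extChartAt (𝓡 m) c).target) {Y : Π p : M, TangentSpace (𝓡 m) p}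
    (hY : ContMDiffAt (𝓡 m) (𝓡 m).tangent ∞ (fun x ↦ (⟨x, Y x⟩ : TangentBundle (𝓡 m) M))
      ((extChartAt (𝓡 m) c).symm y)) : ContDiffAt ℝ ∞ (chartField c Y) y := by
  have hs := (extChartAt (𝓡 m) c).map_target hy
  have h1 : ContMDiffAt 𝓘(ℝ, EuclideanSpace ℝ (Fin m)) (𝓡 m) ∞ (extChartAt (𝓡 m) c).symm y :=
    (contMDiffOn_extChartAt_symm c).contMDiffAt (target_mem_nhds hy)
  have h2 : ContMDiffOn (𝓡 m).tangent 𝓘(ℝ, EuclideanSpace ℝ (Fin m)).tangent ∞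
      (tangentMapWithin (𝓡 m) 𝓘(ℝ, EuclideanSpace ℝ (Fin m)) (extChartAt (𝓡 m) c)
        (extChartAt (𝓡 m) c).source)
      (Bundle.TotalSpace.proj ⁻¹' (extChartAt (𝓡 m) c).source) :=
    ContMDiffOn.contMDiffOn_tangentMapWithin (n := ∞)
      (by rw [extChartAt_source]; exact contMDiffOn_extChartAt) (by simp)
      (isOpen_extChartAt_source c).uniqueMDiffOn
  have hY2 := hY.comp y h1
  have ho : Bundle.TotalSpace.proj ⁻¹' (extChartAt (𝓡 m) c).source ∈
      𝓝 (⟨(extChartAt (𝓡 m) c).symm y, Y ((extChartAt (𝓡 m) c).symm y)⟩ :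
        TangentBundle (𝓡 m) M) :=
    ((isOpen_extChartAt_source c).preimage
      (FiberBundle.continuous_proj (EuclideanSpace ℝ (Fin m)) (TangentSpace (𝓡 m)))).mem_nhds hs
  have h3 := (h2.contMDiffAt ho).comp y hY2
  have h4 := ((contMDiff_snd_tangentBundle_modelSpace (EuclideanSpace ℝ (Fin m))
    𝓘(ℝ, EuclideanSpace ℝ (Fin m))).contMDiffAt.comp y h3).contDiffAt
  refine h4.congr_of_eventuallyEq ?_
  filter_upwards [target_mem_nhds hy] with z hz
  simp only [Function.comp, tangentMapWithin, chartField, components]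
  rw [mfderivWithin_of_isOpen (isOpen_extChartAt_source c) ((extChartAt (𝓡 m) c).map_target hz)]
  rfl

/-- Coordinate fields are smooth along the inverse chart; pairing two of them gives smoothness of
the metric coefficients. -/
theorem contMDiffAt_fromChart {c : M} {y : EuclideanSpace ℝ (Fin m)}
    (hy : y ∈ (extChartAt (𝓡 m) c).target) (w : EuclideanSpace ℝ (Fin m)) :
    ContMDiffAt 𝓘(ℝ, EuclideanSpace ℝ (Fin m)) (𝓡 m).tangent ∞
      (fun z ↦ (⟨(extChartAt (𝓡 m) c).symm z, fromChart c z w⟩ : TangentBundle (𝓡 m) M)) y := by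
  have h2 : ContMDiffOn 𝓘(ℝ, EuclideanSpace ℝ (Fin m)).tangent (𝓡 m).tangent ∞
      (tangentMapWithin 𝓘(ℝ, EuclideanSpace ℝ (Fin m)) (𝓡 m) (extChartAt (𝓡 m) c).symm
        (extChartAt (𝓡 m) c).target)
      (Bundle.TotalSpace.proj ⁻¹' (extChartAt (𝓡 m) c).target) :=
    ContMDiffOn.contMDiffOn_tangentMapWithin (n := ∞) (contMDiffOn_extChartAt_symm c) (by simp)
      (isOpen_extChartAt_target c).uniqueMDiffOn
  have h1 : ContMDiffAt 𝓘(ℝ, EuclideanSpace ℝ (Fin m)) 𝓘(ℝ, EuclideanSpace ℝ (Fin m)).tangent ∞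
      (fun z ↦ (⟨z, w⟩ : TangentBundle 𝓘(ℝ, EuclideanSpace ℝ (Fin m))
        (EuclideanSpace ℝ (Fin m)))) y :=
    contMDiffAt_vectorSpace_iff_contDiffAt.2 contDiffAt_const
  have ho : Bundle.TotalSpace.proj ⁻¹' (extChartAt (𝓡 m) c).target ∈
      𝓝 (⟨y, w⟩ : TangentBundle 𝓘(ℝ, EuclideanSpace ℝ (Fin m)) (EuclideanSpace ℝ (Fin m))) :=
    ((isOpen_extChartAt_target c).preimage (FiberBundle.continuous_proj
      (EuclideanSpace ℝ (Fin m)) (TangentSpace 𝓘(ℝ, EuclideanSpace ℝ (Fin m))))).mem_nhds hy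
  refine ((h2.contMDiffAt ho).comp y h1).congr_of_eventuallyEq ?_
  filter_upwards [target_mem_nhds hy] with z hz
  simp only [Function.comp, tangentMapWithin, fromChart]
  rw [mfderivWithin_of_isOpen (isOpen_extChartAt_target c) hz]
  rfl

/-- The derivative of a function along a tangent vector, computed in a chart. -/
theorem mvfderiv_eq_fderiv {c p : M} (hp : p ∈ (extChartAt (𝓡 m) c).source) {g : M → ℝ}
    {g' : EuclideanSpace ℝ (Fin m) → ℝ} (hg' : DifferentiableAt ℝ g' (extChartAt (𝓡 m) c p))
    (h : ∀ᶠ q in 𝓝 p, g q = g' (extChartAt (𝓡 m) c q)) (v : TangentSpace (𝓡 m) p) :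
    mvfderiv (𝓡 m) g p v = fderiv ℝ g' (extChartAt (𝓡 m) c p) (components c p v) := by
  have := isManifold_one (m := m) (M := M)
  have h1 : MDifferentiableAt (𝓡 m) 𝓘(ℝ, EuclideanSpace ℝ (Fin m)) (extChartAt (𝓡 m) c) p :=
    mdifferentiableAt_extChartAt (by rwa [extChartAt_source] at hp)
  have h2 : mfderiv (𝓡 m) 𝓘(ℝ, ℝ) g p = mfderiv (𝓡 m) 𝓘(ℝ, ℝ) (g' ∘ extChartAt (𝓡 m) c) p :=
    EventuallyEq.mfderiv_eq h
  rw [mfderiv_comp p hg'.mdifferentiableAt h1, mfderiv_eq_fderiv] at h2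
  exact DFunLike.congr_fun h2 v

section Metric

variable [RiemannianBundle (fun x : M ↦ TangentSpace (𝓡 m) x)]

theorem chartMetric_components {c : M} {y : EuclideanSpace ℝ (Fin m)}
    (hy : y ∈ (extChartAt (𝓡 m) c).target) {p : M} (hp : p = (extChartAt (𝓡 m) c).symm y)
    (v w : TangentSpace (𝓡 m) p) :
    chartMetric c y (components c p v) (components c p w) = inner ℝ v w := by
  subst hp
  rw [chartMetric_apply, fromChart_components hy, fromChart_components hy]

theorem inner_eq_chartMetric {c p : M} (hp : p ∈ (extChartAt (𝓡 m) c).source)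
    (v w : TangentSpace (𝓡 m) p) :
    inner ℝ v w =
      chartMetric c (extChartAt (𝓡 m) c p) (components c p v) (components c p w) :=
  (chartMetric_components ((extChartAt (𝓡 m) c).map_source hp)
    ((extChartAt (𝓡 m) c).left_inv hp).symm v w).symm

/-- A definite form is injective into the dual, which has the same finite dimension. -/
theorem isInvertible_of_posDef {E : Type*} [NormedAddCommGroup E] [NormedSpace ℝ E]
    [FiniteDimensional ℝ E] {B : E →L[ℝ] E →L[ℝ] ℝ} (h : ∀ v, B v v = 0 → v = 0) :
    B.IsInvertible := by
  have hinj : Function.Injective B := by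
    refine (injective_iff_map_eq_zero B).2 fun v hv ↦ h v ?_
    simp [hv]
  have hd : Module.finrank ℝ E = Module.finrank ℝ (E →L[ℝ] ℝ) := by
    rw [← (LinearMap.toContinuousLinearMap (𝕜 := ℝ) (E := E) (F' := ℝ)).finrank_eq]
    exact (Subspace.dual_finrank_eq (K := ℝ) (V := E)).symm
  let e := (LinearEquiv.ofInjectiveOfFinrankEq B.toLinearMap hinj hd).toContinuousLinearEquiv
  exact ⟨e, by ext; rfl⟩

/-- In finite dimension smoothness may be checked on each pair of constant vectors. Definiteness of
the inner product provides invertibility. -/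
theorem isMetricAt_chartMetric [IsContMDiffRiemannianBundle (𝓡 m) ∞ (EuclideanSpace ℝ (Fin m))
      (fun x : M ↦ TangentSpace (𝓡 m) x)] {c : M} {y : EuclideanSpace ℝ (Fin m)}
    (hy : y ∈ (extChartAt (𝓡 m) c).target) : IsMetricAt (chartMetric c) y where
  contDiffAt := by
    refine (contDiffOn_clm_apply.2 fun v ↦ contDiffOn_clm_apply.2 fun w ↦ ?_).contDiffAt
      (target_mem_nhds hy)
    intro z hz
    exact (ContMDiffAt.inner_bundle (contMDiffAt_fromChart hz v)
      (contMDiffAt_fromChart hz w)).contDiffAt.contDiffWithinAt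
  symm := Eventually.of_forall fun z v w ↦ by
    rw [chartMetric_apply, chartMetric_apply, real_inner_comm]
  isInvertible := isInvertible_of_posDef fun v hv ↦ by
    rw [chartMetric_apply, inner_self_eq_zero] at hv
    rw [← components_fromChart hy v, hv, map_zero]

end Metric

end Chart

end RiemMap

namespace RiemMap

open Filter Topology LocalMetric

set_option maxSynthPendingDepth 5

/-! ### Distributions, their second fundamental form and mean curvature in a frame -/

section Distribution

variable {m : ℕ} {M : Type*} [TopologicalSpace M] [ChartedSpace (EuclideanSpace ℝ (Fin m)) M]

section CovDeriv

variable [RiemannianBundle (fun x : M ↦ TangentSpace (𝓡 m) x)]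

theorem covDeriv_eq_nabla (Y : Π p : M, TangentSpace (𝓡 m) p) (x : M)
    (v : TangentSpace (𝓡 m) x) :
    covDeriv Y x v = ofComponents x x (nabla (chartMetric x) (chartField x Y)
      (extChartAt (𝓡 m) x x) (components x x v)) := by
  rw [nabla, chartField_extChartAt (mem_extChartAt_source x)]
  rfl

theorem covDeriv_add (Y : Π p : M, TangentSpace (𝓡 m) p) (x : M)
    (v w : TangentSpace (𝓡 m) x) : covDeriv Y x (v + w) = covDeriv Y x v + covDeriv Y x w := by
  simp only [covDeriv_eq_nabla, map_add, nabla_add_dir]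

theorem covDeriv_smul (Y : Π p : M, TangentSpace (𝓡 m) p) (x : M) (c : ℝ)
    (v : TangentSpace (𝓡 m) x) : covDeriv Y x (c • v) = c • covDeriv Y x v := by
  simp only [covDeriv_eq_nabla, map_smul, nabla_smul_dir]

variable [IsManifold (𝓡 m) ∞ M]

theorem inner_covDeriv (Y : Π p : M, TangentSpace (𝓡 m) p) (x : M)
    (v w : TangentSpace (𝓡 m) x) :
    inner ℝ (covDeriv Y x v) w =
      chartMetric x (extChartAt (𝓡 m) x x) (nabla (chartMetric x) (chartField x Y)
        (extChartAt (𝓡 m) x x) (components x x v)) (components x x w) := by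
  rw [inner_eq_chartMetric (mem_extChartAt_source x), covDeriv_eq_nabla,
    components_ofComponents (mem_extChartAt_source x)]

/-- Carries pointwise relations between fields, such as orthonormality, from a neighbourhood in `M`
to one in the chart, where they can be differentiated. -/
theorem eventually_inner_chartField {c p : M} (hp : p ∈ (extChartAt (𝓡 m) c).source)
    {Y Z : Π p : M, TangentSpace (𝓡 m) p} {P : ℝ → Prop}
    (h : ∀ᶠ q in 𝓝 p, P (inner ℝ (Y q) (Z q))) :
    ∀ᶠ y in 𝓝 (extChartAt (𝓡 m) c p), P (chartMetric c y (chartField c Y y) (chartField c Z y)) := by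
  have ht := (extChartAt (𝓡 m) c).map_source hp
  have hc : Tendsto (extChartAt (𝓡 m) c).symm (𝓝 (extChartAt (𝓡 m) c p)) (𝓝 p) := by
    have := continuousAt_extChartAt_symm'' ht
    rwa [ContinuousAt, (extChartAt (𝓡 m) c).left_inv hp] at this
  filter_upwards [hc.eventually h, target_mem_nhds ht] with y h1 h2
  rwa [chartField, chartField, chartMetric_components h2 rfl]

theorem inner_covDeriv_eq_neg [IsContMDiffRiemannianBundle (𝓡 m) ∞ (EuclideanSpace ℝ (Fin m))
      (fun x : M ↦ TangentSpace (𝓡 m) x)] {x : M} {Y Z : Π p : M, TangentSpace (𝓡 m) p}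
    (hY : DifferentiableAt ℝ (chartField x Y) (extChartAt (𝓡 m) x x))
    (hZ : DifferentiableAt ℝ (chartField x Z) (extChartAt (𝓡 m) x x)) {c : ℝ}
    (h : ∀ᶠ p in 𝓝 x, inner ℝ (Y p) (Z p) = c) (v : TangentSpace (𝓡 m) x) :
    inner ℝ (covDeriv Y x v) (Z x) = - inner ℝ (Y x) (covDeriv Z x v) := by
  have hx := mem_extChartAt_source (I := 𝓡 m) x
  rw [real_inner_comm (covDeriv Z x v), inner_covDeriv, inner_covDeriv,
    ← chartField_extChartAt hx, ← chartField_extChartAt hx]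
  have hG := isMetricAt_chartMetric (mem_extChartAt_target (I := 𝓡 m) x)
  rw [hG.symm_self (nabla _ (chartField x Z) _ _)]
  exact hG.nabla_left_eq_neg hY hZ (eventually_inner_chartField (P := (· = c)) hx h) _

end CovDeriv

/-- The orthonormal expansion in a frame of `m` vectors split in two families. -/
theorem eq_sum_of_orthonormal {V : Type*} [NormedAddCommGroup V] [InnerProductSpace ℝ V]
    [FiniteDimensional ℝ V] {ι κ : Type*} [Fintype ι] [Fintype κ] {e : ι → V} {u : κ → V}
    (h : Orthonormal ℝ (Sum.elim e u))
    (hc : Fintype.card ι + Fintype.card κ = Module.finrank ℝ V) (w : V) :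
    w = ∑ i, inner ℝ (e i) w • e i + ∑ α, inner ℝ (u α) w • u α := by
  have hs := h.linearIndependent.span_eq_top_of_card_eq_finrank' (by simpa using hc)
  have := (OrthonormalBasis.mk h hs.ge).sum_repr' w
  simpa using this.symm

theorem starProjection_eq_sum {V : Type*} [NormedAddCommGroup V] [InnerProductSpace ℝ V]
    [FiniteDimensional ℝ V] {ι κ : Type*} [Fintype ι] [Fintype κ] {e : ι → V} {u : κ → V}
    (h : Orthonormal ℝ (Sum.elim e u))
    (hc : Fintype.card ι + Fintype.card κ = Module.finrank ℝ V) {D : Submodule ℝ V}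
    (he : ∀ i, e i ∈ D) (hu : ∀ α, u α ∈ Dᗮ) (w : V) :
    D.starProjection w = ∑ i, inner ℝ (e i) w • e i := by
  conv_lhs => rw [eq_sum_of_orthonormal h hc w]
  have h1 : ∀ i, D.starProjection (e i) = e i := fun i ↦
    Submodule.starProjection_eq_self_iff.2 (he i)
  have h2 : ∀ α, D.starProjection (u α) = 0 := fun α ↦
    (Submodule.starProjection_apply_eq_zero_iff (K := D)).2 (hu α)
  simp [h1, h2]

/-- Near `x`, the fields `e i` form a basis of `D` and the fields `u α` a basis of `Dᗮ`, together
orthonormal; they are differentiable at `x`. -/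
structure IsSplitFrameAt [RiemannianBundle (fun x : M ↦ TangentSpace (𝓡 m) x)]
    {ι κ : Type*} [Fintype ι] [Fintype κ]
    (D : Π p : M, Submodule ℝ (TangentSpace (𝓡 m) p))
    (e : ι → Π p : M, TangentSpace (𝓡 m) p) (u : κ → Π p : M, TangentSpace (𝓡 m) p) (x : M) :
    Prop where
  differentiable_left : ∀ i, DifferentiableAt ℝ (chartField x (e i)) (extChartAt (𝓡 m) x x)
  differentiable_right : ∀ α, DifferentiableAt ℝ (chartField x (u α)) (extChartAt (𝓡 m) x x)
  orthonormal : ∀ᶠ p in 𝓝 x, Orthonormal ℝ (Sum.elim (fun i ↦ e i p) (fun α ↦ u α p))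
  mem_left : ∀ᶠ p in 𝓝 x, ∀ i, e i p ∈ D p
  mem_right : ∀ᶠ p in 𝓝 x, ∀ α, u α p ∈ (D p)ᗮ
  card_eq : Fintype.card ι + Fintype.card κ = m

theorem finrank_tangentSpace (x : M) : Module.finrank ℝ (TangentSpace (𝓡 m) x) = m :=
  finrank_euclideanSpace_fin (𝕜 := ℝ) (n := m)

namespace IsSplitFrameAt

variable [RiemannianBundle (fun x : M ↦ TangentSpace (𝓡 m) x)]
  {ι κ : Type*} [Fintype ι] [Fintype κ] {D : Π p : M, Submodule ℝ (TangentSpace (𝓡 m) p)}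
  {e : ι → Π p : M, TangentSpace (𝓡 m) p} {u : κ → Π p : M, TangentSpace (𝓡 m) p} {x : M}

theorem starProjection (h : IsSplitFrameAt D e u x) :
    ∀ᶠ p in 𝓝 x, ∀ w, (D p).starProjection w = ∑ i, inner ℝ (e i p) w • e i p := by
  filter_upwards [h.orthonormal, h.mem_left, h.mem_right] with p h1 h2 h3 w
  exact starProjection_eq_sum h1 (by rw [h.card_eq, finrank_tangentSpace]) h2 h3 w

theorem orthogonal (h : IsSplitFrameAt D e u x) : IsSplitFrameAt (fun p ↦ (D p)ᗮ) u e x where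
  differentiable_left := h.differentiable_right
  differentiable_right := h.differentiable_left
  orthonormal := by
    filter_upwards [h.orthonormal] with p hp
    have := hp.comp Sum.swap Sum.swap_leftInverse.injective
    convert this using 1
    ext z
    cases z <;> rfl
  mem_left := h.mem_right
  mem_right := by
    filter_upwards [h.mem_left] with p hp i
    exact Submodule.le_orthogonal_orthogonal _ (hp i)
  card_eq := by rw [add_comm, h.card_eq]

/-- The projection formula shows that the independent vectors `e i x` span `D x`. -/
theorem finrank_eq (h : IsSplitFrameAt D e u x) :
    Module.finrank ℝ (D x) = Fintype.card ι := by
  have h1 := h.orthonormal.self_of_nhds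
  have hl : LinearIndependent ℝ (fun i ↦ e i x) :=
    (h1.comp Sum.inl Sum.inl_injective).linearIndependent
  rw [← finrank_span_eq_card hl]
  have : D x = Submodule.span ℝ (Set.range fun i ↦ e i x) := by
    apply le_antisymm
    · intro w hw
      rw [← Submodule.starProjection_eq_self_iff.2 hw, h.starProjection.self_of_nhds w]
      exact Submodule.sum_mem _ fun i _ ↦ Submodule.smul_mem _ _
        (Submodule.subset_span ⟨i, rfl⟩)
    · rw [Submodule.span_le]
      rintro _ ⟨i, rfl⟩
      exact h.mem_left.self_of_nhds i
  rw [this]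

theorem inner_eq_ite [DecidableEq ι] (h : IsSplitFrameAt D e u x) :
    ∀ᶠ p in 𝓝 x, ∀ i j, inner ℝ (e i p) (e j p) = if i = j then (1 : ℝ) else 0 := by
  filter_upwards [h.orthonormal] with p hp i j
  simpa using orthonormal_iff_ite.1 (hp.comp Sum.inl Sum.inl_injective) i j

theorem inner_eq_zero (h : IsSplitFrameAt D e u x) :
    ∀ᶠ p in 𝓝 x, ∀ i α, inner ℝ (e i p) (u α p) = 0 := by
  filter_upwards [h.mem_left, h.mem_right] with p h1 h2 i α
  exact Submodule.inner_right_of_mem_orthogonal (h1 i) (h2 α)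

variable [IsManifold (𝓡 m) ∞ M]
  [IsContMDiffRiemannianBundle (𝓡 m) ∞ (EuclideanSpace ℝ (Fin m))
    (fun x : M ↦ TangentSpace (𝓡 m) x)]

/-- The distribution carries no smoothness assumption of its own: near `x` the projection is `∑ i,
⟨e i, ·⟩ e i`, which inherits differentiability from the frame. -/
theorem differentiableAt_extendIn (h : IsSplitFrameAt D e u x) (w : TangentSpace (𝓡 m) x) :
    DifferentiableAt ℝ (chartField x (extendIn D x w)) (extChartAt (𝓡 m) x x) := by
  have ht := mem_extChartAt_target (I := 𝓡 m) x
  have hG := isMetricAt_chartMetric ht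
  have h1 : DifferentiableAt ℝ (fun y ↦ ∑ i, chartMetric x y (chartField x (e i) y)
      (components x x w) • chartField x (e i) y) (extChartAt (𝓡 m) x x) :=
    DifferentiableAt.fun_sum fun i _ ↦ ((hG.differentiableAt.clm_apply
      (h.differentiable_left i)).clm_apply (differentiableAt_const _)).smul
      (h.differentiable_left i)
  refine h1.congr_of_eventuallyEq ?_
  have hc : Tendsto (extChartAt (𝓡 m) x).symm (𝓝 (extChartAt (𝓡 m) x x)) (𝓝 x) := by
    have := continuousAt_extChartAt_symm'' ht
    rwa [ContinuousAt, (extChartAt (𝓡 m) x).left_inv (mem_extChartAt_source x)] at this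
  filter_upwards [hc.eventually h.starProjection, target_mem_nhds ht] with y hy hyt
  rw [chartField, extendIn, hy, map_sum]
  refine Finset.sum_congr rfl fun i _ ↦ ?_
  rw [map_smul, ← chartMetric_components hyt rfl,
    components_ofComponents ((extChartAt (𝓡 m) x).map_target hyt)]
  rfl

/-- The second fundamental form of `D` in terms of the derivatives of a frame of `Dᗮ`. -/
theorem distSecondFundamentalForm_eq (h : IsSplitFrameAt D e u x)
    (v : TangentSpace (𝓡 m) x) {w : TangentSpace (𝓡 m) x} (hw : w ∈ D x) :
    distSecondFundamentalForm D x v w =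
      ∑ α, (- inner ℝ w (covDeriv (u α) x v)) • u α x := by
  rw [distSecondFundamentalForm, h.orthogonal.starProjection.self_of_nhds]
  refine Finset.sum_congr rfl fun α _ ↦ ?_
  -- The extension stays in `D`, hence orthogonal to `u α`, so the derivative moves onto `u α` and
  -- only the value at `x` of the extension remains.
  have h0 : ∀ᶠ p in 𝓝 x, inner ℝ (extendIn D x w p) (u α p) = 0 := by
    filter_upwards [h.mem_right] with p hp
    exact Submodule.inner_right_of_mem_orthogonal (Submodule.starProjection_apply_mem _ _) (hp α)
  rw [real_inner_comm, inner_covDeriv_eq_neg (h.differentiableAt_extendIn w)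
    (h.differentiable_right α) h0]
  rw [extendIn, ofComponents_components (mem_extChartAt_source x),
    Submodule.starProjection_eq_self_iff.2 hw]

/-- The mean curvature in terms of an orthonormal frame. -/
theorem meanCurvature_eq (h : IsSplitFrameAt D e u x) :
    meanCurvature D x = (Fintype.card ι : ℝ)⁻¹ •
      ∑ α, (∑ i, inner ℝ (covDeriv (e i) x (e i x)) (u α x)) • u α x := by
  -- `S` agrees with the second fundamental form on `D x` and is visibly bilinear on the whole
  -- tangent space, so its trace over `D x` may be taken in the frame `e`.
  let S : TangentSpace (𝓡 m) x →ₗ[ℝ] TangentSpace (𝓡 m) x →ₗ[ℝ] TangentSpace (𝓡 m) x :=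
    LinearMap.mk₂ ℝ (fun v w ↦ ∑ α, (- inner ℝ w (covDeriv (u α) x v)) • u α x)
      (fun v v' w ↦ by
        simp only [covDeriv_add, inner_add_right, neg_add, add_smul, Finset.sum_add_distrib])
      (fun c v w ↦ by
        simp only [covDeriv_smul, inner_smul_right, Finset.smul_sum, smul_smul, mul_neg])
      (fun v w w' ↦ by
        simp only [inner_add_left, neg_add, add_smul, Finset.sum_add_distrib])
      (fun c v w ↦ by
        simp only [real_inner_smul_left, Finset.smul_sum, smul_smul, mul_neg])
  have hS : ∀ v w, S v w = ∑ α, (- inner ℝ w (covDeriv (u α) x v)) • u α x := fun v w ↦ rfl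
  have he := h.mem_left.self_of_nhds
  rw [meanCurvature]
  refine congrArg₂ (· • ·) (by rw [h.finrank_eq]) ?_
  set b := stdOrthonormalBasis ℝ (D x) with hb
  have h1 : ∑ i, distSecondFundamentalForm D x (b i : TangentSpace (𝓡 m) x) (b i) =
      ∑ i, S (b i : TangentSpace (𝓡 m) x) (b i) :=
    Finset.sum_congr rfl fun i _ ↦ by rw [h.distSecondFundamentalForm_eq _ (b i).2, hS]
  rw [h1, sum_apply_self_eq_of_expansion S (b' := fun i ↦ e i x)]
  · simp_rw [hS]
    rw [Finset.sum_comm]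
    refine Finset.sum_congr rfl fun α _ ↦ ?_
    rw [Finset.sum_smul]
    refine Finset.sum_congr rfl fun i _ ↦ ?_
    rw [inner_covDeriv_eq_neg (h.differentiable_left i) (h.differentiable_right α)
      (h.inner_eq_zero.mono fun p hp ↦ hp i α)]
  · intro i
    rw [← h.starProjection.self_of_nhds, Submodule.starProjection_eq_self_iff.2 (b i).2]
  · intro j
    have := congrArg (Submodule.subtype (D x)) (b.sum_repr' ⟨e j x, he j⟩)
    rw [map_sum] at this
    simpa using this.symm

end IsSplitFrameAt

end Distribution

end RiemMap

namespace RiemMap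

open Filter Topology LocalMetric

set_option maxSynthPendingDepth 5

/-! ### Independence of charts, and continuity of the tension field -/

section LocalExpression

variable {m n : ℕ}
  {M : Type*} [TopologicalSpace M] [ChartedSpace (EuclideanSpace ℝ (Fin m)) M]
  {N : Type*} [TopologicalSpace N] [ChartedSpace (EuclideanSpace ℝ (Fin n)) N]

variable (m n) in
/-- The expression of `φ` in the charts centred at `c` and `d`. -/
noncomputable def chartMap (c : M) (d : N) (φ : M → N) (y : EuclideanSpace ℝ (Fin m)) :
    EuclideanSpace ℝ (Fin n) :=
  extChartAt (𝓡 n) d (φ ((extChartAt (𝓡 m) c).symm y))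

theorem tendsto_extChartAt_symm {c : M} {y : EuclideanSpace ℝ (Fin m)}
    (hy : y ∈ (extChartAt (𝓡 m) c).target) :
    Tendsto (extChartAt (𝓡 m) c).symm (𝓝 y) (𝓝 ((extChartAt (𝓡 m) c).symm y)) :=
  continuousAt_extChartAt_symm'' hy

theorem chartMap_extChartAt {c p : M} (hp : p ∈ (extChartAt (𝓡 m) c).source) (d : N)
    (φ : M → N) : chartMap m n c d φ (extChartAt (𝓡 m) c p) = extChartAt (𝓡 n) d (φ p) := by
  rw [chartMap, (extChartAt (𝓡 m) c).left_inv hp]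

theorem secondFundamentalForm_self [RiemannianBundle (fun x : M ↦ TangentSpace (𝓡 m) x)]
    [RiemannianBundle (fun y : N ↦ TangentSpace (𝓡 n) y)] (φ : M → N) (x : M) (v w : TangentSpace (𝓡 m) x) :
    secondFundamentalForm (m := m) (n := n) φ x v w = ofComponents (φ x) (φ x)
      (hess (chartMetric x) (chartMetric (φ x)) (chartMap m n x (φ x) φ) (extChartAt (𝓡 m) x x)
        (components x x v) (components x x w)) := by
  rw [hess, chartMap_extChartAt (mem_extChartAt_source x)]
  rfl

theorem eventually_chartMap_mem {φ : M → N} (hφ : ContMDiff (𝓡 m) (𝓡 n) ∞ φ) {c : M} {d : N}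
    {y : EuclideanSpace ℝ (Fin m)} (hy : y ∈ (extChartAt (𝓡 m) c).target)
    (hd : φ ((extChartAt (𝓡 m) c).symm y) ∈ (extChartAt (𝓡 n) d).source) :
    ∀ᶠ z in 𝓝 y, z ∈ (extChartAt (𝓡 m) c).target ∧
      φ ((extChartAt (𝓡 m) c).symm z) ∈ (extChartAt (𝓡 n) d).source :=
  Filter.Eventually.and (target_mem_nhds hy)
    ((hφ.continuous.continuousAt.tendsto.comp (tendsto_extChartAt_symm hy)).eventually
      ((isOpen_extChartAt_source d).mem_nhds hd))

variable [IsManifold (𝓡 m) ∞ M] [IsManifold (𝓡 n) ∞ N] {φ : M → N}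

theorem ofComponents_eq_zero_iff {c p : M} (hp : p ∈ (extChartAt (𝓡 m) c).source)
    {v : EuclideanSpace ℝ (Fin m)} : ofComponents c p v = 0 ↔ v = 0 := by
  refine ⟨fun h ↦ ?_, fun h ↦ by rw [h, map_zero]⟩
  rw [← components_ofComponents hp v, h, map_zero]

theorem contDiffAt_chartMap (hφ : ContMDiff (𝓡 m) (𝓡 n) ∞ φ) {c : M} {d : N}
    {y : EuclideanSpace ℝ (Fin m)} (hy : y ∈ (extChartAt (𝓡 m) c).target)
    (hd : φ ((extChartAt (𝓡 m) c).symm y) ∈ (extChartAt (𝓡 n) d).source) :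
    ContDiffAt ℝ ∞ (chartMap m n c d φ) y := by
  have h1 := (contMDiffOn_extChartAt_symm (I := 𝓡 m) (n := ∞) c).contMDiffAt (target_mem_nhds hy)
  have h2 : ContMDiffAt (𝓡 n) 𝓘(ℝ, EuclideanSpace ℝ (Fin n)) ∞ (extChartAt (𝓡 n) d)
      (φ ((extChartAt (𝓡 m) c).symm y)) :=
    contMDiffAt_extChartAt' (by rwa [extChartAt_source] at hd)
  have h3 := hφ.contMDiffAt.comp y h1
  exact (ContMDiffAt.comp y h2 h3).contDiffAt

theorem fderiv_chartMap (hφ : ContMDiff (𝓡 m) (𝓡 n) ∞ φ) {c : M} {d : N}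
    {y : EuclideanSpace ℝ (Fin m)} (hy : y ∈ (extChartAt (𝓡 m) c).target)
    (hd : φ ((extChartAt (𝓡 m) c).symm y) ∈ (extChartAt (𝓡 n) d).source)
    (v : EuclideanSpace ℝ (Fin m)) :
    fderiv ℝ (chartMap m n c d φ) y v = components d (φ ((extChartAt (𝓡 m) c).symm y))
      (mfderiv (𝓡 m) (𝓡 n) φ ((extChartAt (𝓡 m) c).symm y) (fromChart c y v)) := by
  have := isManifold_one (m := n) (M := N)
  have h1 : MDifferentiableAt 𝓘(ℝ, EuclideanSpace ℝ (Fin m)) (𝓡 m) (extChartAt (𝓡 m) c).symm y :=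
    ((contMDiffOn_extChartAt_symm (I := 𝓡 m) (n := ∞) c).contMDiffAt
      (target_mem_nhds hy)).mdifferentiableAt (by simp)
  have h2 : MDifferentiableAt (𝓡 n) 𝓘(ℝ, EuclideanSpace ℝ (Fin n)) (extChartAt (𝓡 n) d)
      (φ ((extChartAt (𝓡 m) c).symm y)) :=
    mdifferentiableAt_extChartAt (by rwa [extChartAt_source] at hd)
  have h3 : MDifferentiableAt (𝓡 m) (𝓡 n) φ ((extChartAt (𝓡 m) c).symm y) :=
    hφ.mdifferentiableAt (by simp)
  have h4 : mfderiv 𝓘(ℝ, EuclideanSpace ℝ (Fin m)) 𝓘(ℝ, EuclideanSpace ℝ (Fin n))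
      (extChartAt (𝓡 n) d ∘ φ ∘ (extChartAt (𝓡 m) c).symm) y =
      (mfderiv (𝓡 n) 𝓘(ℝ, EuclideanSpace ℝ (Fin n)) (extChartAt (𝓡 n) d)
        (φ ((extChartAt (𝓡 m) c).symm y))).comp
      ((mfderiv (𝓡 m) (𝓡 n) φ ((extChartAt (𝓡 m) c).symm y)).comp
      (mfderiv 𝓘(ℝ, EuclideanSpace ℝ (Fin m)) (𝓡 m) (extChartAt (𝓡 m) c).symm y)) := by
    rw [mfderiv_comp y h2 (h3.comp y h1), mfderiv_comp y h3 h1]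
    rfl
  rw [mfderiv_eq_fderiv] at h4
  exact DFunLike.congr_fun h4 v

theorem fderiv_chartMap_components (hφ : ContMDiff (𝓡 m) (𝓡 n) ∞ φ) {c p : M} {d : N}
    (hp : p ∈ (extChartAt (𝓡 m) c).source) (hd : φ p ∈ (extChartAt (𝓡 n) d).source)
    (v : TangentSpace (𝓡 m) p) :
    fderiv ℝ (chartMap m n c d φ) (extChartAt (𝓡 m) c p) (components c p v) =
      components d (φ p) (mfderiv (𝓡 m) (𝓡 n) φ p v) := by
  obtain ⟨y, hy, rfl⟩ : ∃ y ∈ (extChartAt (𝓡 m) c).target, (extChartAt (𝓡 m) c).symm y = p :=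
    ⟨_, (extChartAt (𝓡 m) c).map_source hp, (extChartAt (𝓡 m) c).left_inv hp⟩
  rw [(extChartAt (𝓡 m) c).right_inv hy, fderiv_chartMap hφ hy hd, fromChart_components hy]

theorem chartMetric_fderiv_chartMap [RiemannianBundle (fun y : N ↦ TangentSpace (𝓡 n) y)]
    (hφ : ContMDiff (𝓡 m) (𝓡 n) ∞ φ) {c : M} {d : N}
    {y : EuclideanSpace ℝ (Fin m)} (hy : y ∈ (extChartAt (𝓡 m) c).target)
    (hd : φ ((extChartAt (𝓡 m) c).symm y) ∈ (extChartAt (𝓡 n) d).source)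
    (v w : EuclideanSpace ℝ (Fin m)) :
    chartMetric d (chartMap m n c d φ y) (fderiv ℝ (chartMap m n c d φ) y v)
        (fderiv ℝ (chartMap m n c d φ) y w) =
      pullbackMetric (m := m) (n := n) φ ((extChartAt (𝓡 m) c).symm y) (fromChart c y v)
        (fromChart c y w) := by
  rw [pullbackMetric, inner_eq_chartMetric hd, fderiv_chartMap hφ hy hd, fderiv_chartMap hφ hy hd]
  rfl

variable [RiemannianBundle (fun x : M ↦ TangentSpace (𝓡 m) x)]
  [RiemannianBundle (fun y : N ↦ TangentSpace (𝓡 n) y)]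

/-- Changes of charts are isometries, so their second fundamental forms vanish. -/
theorem hess_chartMap_id [IsContMDiffRiemannianBundle (𝓡 m) ∞ (EuclideanSpace ℝ (Fin m))
      (fun x : M ↦ TangentSpace (𝓡 m) x)] {c d p : M} (hc : p ∈ (extChartAt (𝓡 m) c).source)
    (hd : p ∈ (extChartAt (𝓡 m) d).source) (v w : EuclideanSpace ℝ (Fin m)) :
    hess (chartMetric c) (chartMetric d) (chartMap m m c d (id : M → M)) (extChartAt (𝓡 m) c p) v w =
      0 := by
  have hid : ContMDiff (𝓡 m) (𝓡 m) ∞ (id : M → M) := contMDiff_id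
  have hy := (extChartAt (𝓡 m) c).map_source hc
  have hl := (extChartAt (𝓡 m) c).left_inv hc
  have hd' : id ((extChartAt (𝓡 m) c).symm (extChartAt (𝓡 m) c p)) ∈
      (extChartAt (𝓡 m) d).source := by rwa [id, hl]
  refine hess_eq_zero_of_isometry (isMetricAt_chartMetric hy) ?_
    (contDiffAt_chartMap hid hy hd') ?_ ?_ v w
  · rw [chartMap_extChartAt hc]
    exact isMetricAt_chartMetric ((extChartAt (𝓡 m) d).map_source hd)
  · intro z
    refine ⟨components c p (ofComponents d p z), ?_⟩
    rw [fderiv_chartMap_components hid hc hd, mfderiv_id]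
    exact components_ofComponents hd z
  · filter_upwards [eventually_chartMap_mem hid hy hd'] with z hz v w
    rw [chartMetric_fderiv_chartMap hid hz.1 hz.2, pullbackMetric, mfderiv_id, chartMetric_apply]
    rfl

variable [IsContMDiffRiemannianBundle (𝓡 m) ∞ (EuclideanSpace ℝ (Fin m))
    (fun x : M ↦ TangentSpace (𝓡 m) x)]
  [IsContMDiffRiemannianBundle (𝓡 n) ∞ (EuclideanSpace ℝ (Fin n))
    (fun y : N ↦ TangentSpace (𝓡 n) y)]

/-- The second fundamental form may be computed in any charts. -/
theorem secondFundamentalForm_eq (hφ : ContMDiff (𝓡 m) (𝓡 n) ∞ φ) {c p : M} {d : N}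
    (hp : p ∈ (extChartAt (𝓡 m) c).source) (hd : φ p ∈ (extChartAt (𝓡 n) d).source)
    (v w : TangentSpace (𝓡 m) p) :
    secondFundamentalForm (m := m) (n := n) φ p v w = ofComponents d (φ p)
      (hess (chartMetric c) (chartMetric d) (chartMap m n c d φ) (extChartAt (𝓡 m) c p)
        (components c p v) (components c p w)) := by
  have hidM : ContMDiff (𝓡 m) (𝓡 m) ∞ (id : M → M) := contMDiff_id
  have hidN : ContMDiff (𝓡 n) (𝓡 n) ∞ (id : N → N) := contMDiff_id
  have hpp := mem_extChartAt_source (I := 𝓡 m) p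
  have hφp := mem_extChartAt_source (I := 𝓡 n) (φ p)
  have hy := (extChartAt (𝓡 m) c).map_source hp
  have hl := (extChartAt (𝓡 m) c).left_inv hp
  have hz := (extChartAt (𝓡 n) d).map_source hd
  have hlz := (extChartAt (𝓡 n) d).left_inv hd
  have hψ : ContDiffAt ℝ ∞ (chartMap m m c p (id : M → M)) (extChartAt (𝓡 m) c p) :=
    contDiffAt_chartMap hidM hy (by rwa [id, hl])
  have hχ : ContDiffAt ℝ ∞ (chartMap n n d (φ p) (id : N → N)) (extChartAt (𝓡 n) d (φ p)) :=
    contDiffAt_chartMap hidN hz (by rwa [id, hlz])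
  have hf : ContDiffAt ℝ ∞ (chartMap m n c d φ) (extChartAt (𝓡 m) c p) :=
    contDiffAt_chartMap hφ hy (by rwa [hl])
  have hf' : ContDiffAt ℝ ∞ (chartMap m n p (φ p) φ) (extChartAt (𝓡 m) p p) :=
    contDiffAt_chartMap hφ (mem_extChartAt_target p)
      (by rwa [(extChartAt (𝓡 m) p).left_inv hpp])
  -- The two coordinate expressions of `φ` differ by changes of charts at the source and at the
  -- target.
  have hcomp : chartMap m n p (φ p) φ ∘ chartMap m m c p (id : M → M) =ᶠ[𝓝 (extChartAt (𝓡 m) c p)]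
      chartMap n n d (φ p) (id : N → N) ∘ chartMap m n c d φ := by
    filter_upwards [eventually_chartMap_mem hidM hy (d := p) (by rwa [id, hl]),
      eventually_chartMap_mem hφ hy (d := d) (by rwa [hl])] with z h1 h2
    simp only [Function.comp, chartMap, id]
    rw [(extChartAt (𝓡 n) d).left_inv h2.2]
    exact congrArg (fun q ↦ extChartAt (𝓡 n) (φ p) (φ q)) ((extChartAt (𝓡 m) p).left_inv h1.2)
  have e1 : chartMap m m c p (id : M → M) (extChartAt (𝓡 m) c p) = extChartAt (𝓡 m) p p :=
    chartMap_extChartAt hp p id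
  have e2 : chartMap m n c d φ (extChartAt (𝓡 m) c p) = extChartAt (𝓡 n) d (φ p) :=
    chartMap_extChartAt hp d φ
  -- Expand both sides with `hess_comp`. The second fundamental forms of the changes of charts
  -- vanish, so the two Hessians correspond under the differential of the change of charts at the
  -- target.
  have key := hess_congr (G := chartMetric c) (H := chartMetric (φ p)) hcomp (components c p v)
    (components c p w)
  rw [hess_comp (H := chartMetric p) hψ (by rwa [e1]),
    hess_comp (H := chartMetric d) hf (by rwa [e2]), hess_chartMap_id hp hpp, map_zero, add_zero,
    e1, e2, hess_chartMap_id hd hφp, zero_add, fderiv_chartMap_components hidM hp hpp,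
    fderiv_chartMap_components hidM hp hpp, mfderiv_id] at key
  rw [secondFundamentalForm_self]
  refine (congrArg (ofComponents (φ p) (φ p)) key).trans ?_
  conv_lhs =>
    enter [2, 2]
    rw [← components_ofComponents hd (hess (chartMetric c) (chartMetric d) (chartMap m n c d φ)
      (extChartAt (𝓡 m) c p) (components c p v) (components c p w))]
  rw [fderiv_chartMap_components hidN hd hφp, mfderiv_id]
  exact ofComponents_components hφp _

/-- The tension field may be computed in any charts. -/
theorem tension_eq (hφ : ContMDiff (𝓡 m) (𝓡 n) ∞ φ) {c p : M} {d : N}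
    (hp : p ∈ (extChartAt (𝓡 m) c).source) (hd : φ p ∈ (extChartAt (𝓡 n) d).source)
    {ι : Type*} [Fintype ι] (s : Module.Basis ι ℝ (EuclideanSpace ℝ (Fin m))) :
    tension (m := m) (n := n) φ p = ofComponents d (φ p)
      (laplace s (chartMetric c) (chartMetric d) (chartMap m n c d φ) (extChartAt (𝓡 m) c p)) := by
  rw [tension, metricTrace, laplace_eq_sum s
    (isMetricAt_chartMetric ((extChartAt (𝓡 m) c).map_source hp))
    (b := fun i ↦ components c p (stdOrthonormalBasis ℝ (TangentSpace (𝓡 m) p) i)), map_sum]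
  · exact Finset.sum_congr rfl fun i _ ↦ secondFundamentalForm_eq hφ hp hd _ _
  · intro w
    conv_lhs => rw [← components_ofComponents hp w,
      ← (stdOrthonormalBasis ℝ (TangentSpace (𝓡 m) p)).sum_repr' (ofComponents c p w), map_sum]
    refine Finset.sum_congr rfl fun i _ ↦ ?_
    rw [map_smul, inner_eq_chartMetric hp, components_ofComponents hp]

/-- A map whose tension field vanishes on a dense set is harmonic. -/
theorem isHarmonic_of_dense (hφ : ContMDiff (𝓡 m) (𝓡 n) ∞ φ) {S : Set M} (hS : Dense S)
    (h : ∀ x ∈ S, tension (m := m) (n := n) φ x = 0) : IsHarmonic (m := m) (n := n) φ := by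
  intro x
  have hx := mem_extChartAt_source (I := 𝓡 m) x
  have hφx := mem_extChartAt_source (I := 𝓡 n) (φ x)
  have ht := mem_extChartAt_target (I := 𝓡 m) x
  let s := (EuclideanSpace.basisFun (Fin m) ℝ).toBasis
  rw [tension_eq hφ hx hφx s, ofComponents_eq_zero_iff hφx]
  -- Both charts stay fixed while `p` moves, so the components lie in a single vector space and
  -- their continuity makes sense.
  have hcont : ContinuousAt (fun p ↦ laplace s (chartMetric x) (chartMetric (φ x))
      (chartMap m n x (φ x) φ) (extChartAt (𝓡 m) x p)) x := by
    refine ContinuousAt.comp (g := laplace s (chartMetric x) (chartMetric (φ x))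
      (chartMap m n x (φ x) φ)) (continuousAt_laplace s (isMetricAt_chartMetric ht) ?_
      (contDiffAt_chartMap hφ ht ?_)) (continuousAt_extChartAt x)
    · rw [chartMap_extChartAt hx]
      exact isMetricAt_chartMetric (mem_extChartAt_target _)
    · rwa [(extChartAt (𝓡 m) x).left_inv hx]
  by_contra hne
  have hev : ∀ᶠ p in 𝓝 x, p ∈ (extChartAt (𝓡 m) x).source ∧
      φ p ∈ (extChartAt (𝓡 n) (φ x)).source ∧ laplace s (chartMetric x) (chartMetric (φ x))
      (chartMap m n x (φ x) φ) (extChartAt (𝓡 m) x p) ≠ 0 :=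
    Filter.Eventually.and ((isOpen_extChartAt_source x).mem_nhds hx)
      ((hφ.continuous.continuousAt.eventually ((isOpen_extChartAt_source (φ x)).mem_nhds hφx)).and
        (hcont.eventually_ne hne))
  obtain ⟨p, hpS, hp⟩ := hS.inter_nhds_nonempty hev
  have := h p hpS
  rw [tension_eq hφ hp.1 hp.2.1 s, ofComponents_eq_zero_iff hp.2.1] at this
  exact hp.2.2 this

end LocalExpression

end RiemMap

namespace RiemMap

open Filter Topology LocalMetric

set_option maxSynthPendingDepth 5

/-! ### Adapted eigenframes -/

section Eigenframe

variable {m n : ℕ}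
  {M : Type*} [TopologicalSpace M] [ChartedSpace (EuclideanSpace ℝ (Fin m)) M]
  {N : Type*} [TopologicalSpace N] [ChartedSpace (EuclideanSpace ℝ (Fin n)) N]

theorem mfderiv_eq_zero_of_mem_vertical {φ : M → N} {x : M} {v : TangentSpace (𝓡 m) x}
    (hv : v ∈ vertical (m := m) (n := n) φ x) : mfderiv (𝓡 m) (𝓡 n) φ x v = 0 :=
  LinearMap.mem_ker.1 hv

theorem metricTrace_eq_sum {W : Type*} [AddCommGroup W] [Module ℝ W]
    [RiemannianBundle (fun x : M ↦ TangentSpace (𝓡 m) x)] {x : M}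
    (B : TangentSpace (𝓡 m) x →ₗ[ℝ] TangentSpace (𝓡 m) x →ₗ[ℝ] W)
    {ι κ : Type*} [Fintype ι] [Fintype κ]
    {e : ι → TangentSpace (𝓡 m) x} {u : κ → TangentSpace (𝓡 m) x}
    (h : Orthonormal ℝ (Sum.elim e u)) (hc : Fintype.card ι + Fintype.card κ = m) :
    metricTrace (fun v w ↦ B v w) = ∑ i, B (e i) (e i) + ∑ α, B (u α) (u α) := by
  rw [metricTrace, sum_apply_self_eq_of_expansion B (b' := Sum.elim e u),
    Fintype.sum_sum_type]
  · rfl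
  · intro i
    rw [Fintype.sum_sum_type]
    exact eq_sum_of_orthonormal h (by rw [hc, finrank_tangentSpace]) _
  · intro j
    exact ((stdOrthonormalBasis ℝ (TangentSpace (𝓡 m) x)).sum_repr' _).symm

theorem eventually_symm_mem {U : Set M} {x : M} (hU : IsOpen U) (hx : x ∈ U) :
    ∀ᶠ y in 𝓝 (extChartAt (𝓡 m) x x), (extChartAt (𝓡 m) x).symm y ∈ U := by
  have := tendsto_extChartAt_symm (mem_extChartAt_target (I := 𝓡 m) x)
  rw [(extChartAt (𝓡 m) x).left_inv (mem_extChartAt_source x)] at this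
  exact this.eventually (hU.mem_nhds hx)

variable [RiemannianBundle (fun x : M ↦ TangentSpace (𝓡 m) x)]
  [RiemannianBundle (fun y : N ↦ TangentSpace (𝓡 n) y)]

/-- The first fundamental form as a bilinear map. -/
noncomputable def pullbackLin (φ : M → N) (x : M) :
    TangentSpace (𝓡 m) x →ₗ[ℝ] TangentSpace (𝓡 m) x →ₗ[ℝ] ℝ :=
  LinearMap.mk₂ ℝ (pullbackMetric (m := m) (n := n) φ x)
    (fun u v w ↦ by simp only [pullbackMetric, map_add, inner_add_left])
    (fun c v w ↦ by simp only [pullbackMetric, map_smul, real_inner_smul_left, smul_eq_mul])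
    (fun u v w ↦ by simp only [pullbackMetric, map_add, inner_add_right])
    (fun c v w ↦ by simp only [pullbackMetric, map_smul, real_inner_smul_right, smul_eq_mul])

namespace IsAdaptedEigenframeOn

variable [IsManifold (𝓡 m) ∞ M]
  {φ : M → N} {U : Set M} {E : Fin n → Π x : M, TangentSpace (𝓡 m) x}
  {V : Fin (m - n) → Π x : M, TangentSpace (𝓡 m) x} {lam : Fin n → M → ℝ} {x : M}

/-- Surjectivity of `dφ` at a point of `U` ensures that the truncated subtraction in `Fin (m - n)`
is the true difference. -/
theorem le_dim (h : IsAdaptedEigenframeOn (m := m) (n := n) φ U E V lam) (hx : x ∈ U) : n ≤ m := by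
  have h1 := LinearMap.finrank_le_finrank_of_surjective
    (f := (mfderiv (𝓡 m) (𝓡 n) φ x).toLinearMap) (h.subset_regularSet hx)
  rwa [finrank_tangentSpace, finrank_tangentSpace] at h1

theorem card_add (h : IsAdaptedEigenframeOn (m := m) (n := n) φ U E V lam) (hx : x ∈ U) :
    Fintype.card (Fin n) + Fintype.card (Fin (m - n)) = m := by
  have := h.le_dim hx
  simp only [Fintype.card_fin]
  omega

theorem norm_E (h : IsAdaptedEigenframeOn (m := m) (n := n) φ U E V lam) (hx : x ∈ U) (i : Fin n) :
    inner ℝ (E i x) (E i x) = 1 := by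
  have := (h.orthonormal x hx).1 (Sum.inl i)
  rw [real_inner_self_eq_norm_sq]
  simp_all

theorem pullbackMetric_E (h : IsAdaptedEigenframeOn (m := m) (n := n) φ U E V lam) (hx : x ∈ U)
    (i : Fin n) : pullbackMetric (m := m) (n := n) φ x (E i x) (E i x) = lam i x ^ 2 := by
  rw [h.eigen_E x hx i, h.norm_E hx, mul_one]

/-- If `λ_i` were zero, `dφ E_i` would have zero norm; `E_i` would then be both vertical and
horizontal, contradicting unit length. Positivity legitimates the logarithms and their derivatives.
-/
theorem lam_pos (h : IsAdaptedEigenframeOn (m := m) (n := n) φ U E V lam) (hx : x ∈ U)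
    (i : Fin n) : 0 < lam i x := by
  refine lt_of_le_of_ne (h.lam_nonneg x hx i) fun h0 ↦ ?_
  have h1 := h.pullbackMetric_E hx i
  rw [← h0, pullbackMetric, sq, mul_zero, inner_self_eq_zero] at h1
  have h2 : inner ℝ (E i x) (E i x) = 0 :=
    Submodule.inner_right_of_mem_orthogonal (K := vertical (m := m) (n := n) φ x)
      (LinearMap.mem_ker.2 h1) (h.horizontal_E x hx i)
  rw [h.norm_E hx] at h2
  exact one_ne_zero h2

theorem energyDensity_eq (h : IsAdaptedEigenframeOn (m := m) (n := n) φ U E V lam) (hx : x ∈ U) :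
    energyDensity (m := m) (n := n) φ x = 1 / 2 * ∑ i, lam i x ^ 2 := by
  have h1 : metricTrace (pullbackMetric (m := m) (n := n) φ x) =
      metricTrace (fun v w ↦ pullbackLin (m := m) (n := n) φ x v w) := rfl
  rw [energyDensity, h1, metricTrace_eq_sum _ (h.orthonormal x hx) (h.card_add hx)]
  have h2 : ∀ α, pullbackLin (m := m) (n := n) φ x (V α x) (V α x) = 0 := fun α ↦ by
    change inner ℝ (mfderiv (𝓡 m) (𝓡 n) φ x (V α x)) _ = (0 : ℝ)
    rw [mfderiv_eq_zero_of_mem_vertical (h.vertical_V x hx α), inner_zero_left]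
  have h3 : ∀ i, pullbackLin (m := m) (n := n) φ x (E i x) (E i x) = lam i x ^ 2 :=
    h.pullbackMetric_E hx
  simp [h2, h3]

theorem differentiableAt_E (h : IsAdaptedEigenframeOn (m := m) (n := n) φ U E V lam)
    (hU : IsOpen U) (hx : x ∈ U)
    (i : Fin n) : DifferentiableAt ℝ (chartField x (E i)) (extChartAt (𝓡 m) x x) := by
  refine (contDiffAt_chartField (mem_extChartAt_target x) ?_).differentiableAt (by simp)
  rw [(extChartAt (𝓡 m) x).left_inv (mem_extChartAt_source x)]
  exact (h.smooth_E i).contMDiffAt (hU.mem_nhds hx)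

theorem differentiableAt_V (h : IsAdaptedEigenframeOn (m := m) (n := n) φ U E V lam)
    (hU : IsOpen U) (hx : x ∈ U)
    (α : Fin (m - n)) : DifferentiableAt ℝ (chartField x (V α)) (extChartAt (𝓡 m) x x) := by
  refine (contDiffAt_chartField (mem_extChartAt_target x) ?_).differentiableAt (by simp)
  rw [(extChartAt (𝓡 m) x).left_inv (mem_extChartAt_source x)]
  exact (h.smooth_V α).contMDiffAt (hU.mem_nhds hx)

theorem isSplitFrameAt_horizontal (h : IsAdaptedEigenframeOn (m := m) (n := n) φ U E V lam)
    (hU : IsOpen U)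
    (hx : x ∈ U) : IsSplitFrameAt (horizontal (m := m) (n := n) φ) E V x where
  differentiable_left := h.differentiableAt_E hU hx
  differentiable_right := h.differentiableAt_V hU hx
  orthonormal := by
    filter_upwards [hU.mem_nhds hx] with p hp using h.orthonormal p hp
  mem_left := by
    filter_upwards [hU.mem_nhds hx] with p hp using h.horizontal_E p hp
  mem_right := by
    filter_upwards [hU.mem_nhds hx] with p hp α
    exact Submodule.le_orthogonal_orthogonal _ (h.vertical_V p hp α)
  card_eq := h.card_add hx

theorem isSplitFrameAt_vertical (h : IsAdaptedEigenframeOn (m := m) (n := n) φ U E V lam)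
    (hU : IsOpen U)
    (hx : x ∈ U) : IsSplitFrameAt (vertical (m := m) (n := n) φ) V E x where
  differentiable_left := h.differentiableAt_V hU hx
  differentiable_right := h.differentiableAt_E hU hx
  orthonormal := (h.isSplitFrameAt_horizontal hU hx).orthogonal.orthonormal
  mem_left := by
    filter_upwards [hU.mem_nhds hx] with p hp using h.vertical_V p hp
  mem_right := by
    filter_upwards [hU.mem_nhds hx] with p hp using h.horizontal_E p hp
  card_eq := by rw [add_comm, h.card_add hx]

theorem verticalGrad_eq (h : IsAdaptedEigenframeOn (m := m) (n := n) φ U E V lam)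
    (hU : IsOpen U) (hx : x ∈ U) (f : M → ℝ) :
    verticalGrad (m := m) (n := n) φ f x = ∑ α, mvfderiv (𝓡 m) f x (V α x) • V α x := by
  rw [verticalGrad, (h.isSplitFrameAt_vertical hU hx).starProjection.self_of_nhds]
  refine Finset.sum_congr rfl fun α _ ↦ ?_
  rw [real_inner_comm, grad, InnerProductSpace.toDual_symm_apply]

/-- Test conformality on `E_i`; here `dφ ≠ 0` because `λ_i > 0`. -/
theorem lam_eq_dil (h : IsAdaptedEigenframeOn (m := m) (n := n) φ U E V lam) {dil : M → ℝ}
    (hdil : IsHorizontallyWeaklyConformal (m := m) (n := n) φ dil) (hx : x ∈ U) (i : Fin n) :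
    lam i x = dil x := by
  have h0 : mfderiv (𝓡 m) (𝓡 n) φ x ≠ 0 := fun h0 ↦ by
    have h1 := h.pullbackMetric_E hx i
    rw [pullbackMetric, h0, zero_apply, inner_zero_left] at h1
    exact pow_ne_zero 2 (h.lam_pos hx i).ne' h1.symm
  have h1 := hdil.conformal x h0 _ (h.horizontal_E x hx i) _ (h.horizontal_E x hx i)
  rw [h.pullbackMetric_E hx, h.norm_E hx, mul_one] at h1
  exact (pow_left_inj₀ (h.lam_nonneg x hx i) (hdil.dil_pos x h0).le two_ne_zero).1 h1

theorem sum_inner_covDeriv_V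
    [IsContMDiffRiemannianBundle (𝓡 m) ∞ (EuclideanSpace ℝ (Fin m))
      (fun x : M ↦ TangentSpace (𝓡 m) x)]
    (h : IsAdaptedEigenframeOn (m := m) (n := n) φ U E V lam)
    (hU : IsOpen U) (hx : x ∈ U) (k : Fin n) :
    ((m : ℝ) - n) * inner ℝ (meanCurvature (vertical (m := m) (n := n) φ) x) (E k x) =
      ∑ α, inner ℝ (covDeriv (V α) x (V α x)) (E k x) := by
  have hS := h.isSplitFrameAt_vertical hU hx
  have h1 : ∀ j, inner ℝ (E j x) (E k x) = if j = k then (1 : ℝ) else 0 := fun j ↦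
    (h.isSplitFrameAt_horizontal hU hx).inner_eq_ite.self_of_nhds j k
  rw [hS.meanCurvature_eq, Fintype.card_fin, real_inner_smul_left, sum_inner]
  simp only [real_inner_smul_left, h1, mul_ite, mul_one, mul_zero, Finset.sum_ite_eq',
    Finset.mem_univ, if_true]
  rw [← Nat.cast_sub (h.le_dim hx)]
  -- When `m = n` there are no vertical fields and both sides are zero; otherwise `m - n` cancels
  -- the normalisation of the mean curvature.
  rcases Nat.eq_zero_or_pos (m - n) with h0 | h0
  · have : IsEmpty (Fin (m - n)) := by rw [h0]; infer_instance
    simp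
  · rw [mul_inv_cancel_left₀]
    positivity

variable [IsManifold (𝓡 n) ∞ N]

theorem fderiv_chartField_V (h : IsAdaptedEigenframeOn (m := m) (n := n) φ U E V lam)
    (hU : IsOpen U) (hφ : ContMDiff (𝓡 m) (𝓡 n) ∞ φ)
    (hx : x ∈ U) (α : Fin (m - n)) : ∀ᶠ y in 𝓝 (extChartAt (𝓡 m) x x),
      fderiv ℝ (chartMap m n x (φ x) φ) y (chartField x (V α) y) = 0 := by
  have ht := mem_extChartAt_target (I := 𝓡 m) x
  filter_upwards [eventually_symm_mem hU hx, eventually_chartMap_mem hφ ht (d := φ x)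
    (by rw [(extChartAt (𝓡 m) x).left_inv (mem_extChartAt_source x)]
        exact mem_extChartAt_source _)] with y h1 h2
  rw [fderiv_chartMap hφ h2.1 h2.2, chartField, fromChart_components h2.1,
    mfderiv_eq_zero_of_mem_vertical (h.vertical_V _ h1 α), map_zero]

theorem isEigenfield_E (h : IsAdaptedEigenframeOn (m := m) (n := n) φ U E V lam)
    (hU : IsOpen U) (hφ : ContMDiff (𝓡 m) (𝓡 n) ∞ φ)
    (hx : x ∈ U) (i : Fin n) :
    IsEigenfield (chartMetric x) (chartMetric (φ x)) (chartMap m n x (φ x) φ)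
      (chartField x (E i)) (fun y ↦ lam i ((extChartAt (𝓡 m) x).symm y) ^ 2)
      (extChartAt (𝓡 m) x x) where
  differentiableAt := h.differentiableAt_E hU hx i
  unit := by
    refine eventually_inner_chartField (P := (· = 1)) (mem_extChartAt_source x) ?_
    filter_upwards [hU.mem_nhds hx] with p hp using h.norm_E hp i
  eigen := by
    have ht := mem_extChartAt_target (I := 𝓡 m) x
    filter_upwards [eventually_symm_mem hU hx, eventually_chartMap_mem hφ ht (d := φ x)
      (by rw [(extChartAt (𝓡 m) x).left_inv (mem_extChartAt_source x)]
          exact mem_extChartAt_source _)] with y h1 h2 w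
    rw [chartMetric_fderiv_chartMap hφ h2.1 h2.2, chartMetric_apply, chartField,
      fromChart_components h2.1]
    exact h.eigen_E _ h1 i _

variable [IsContMDiffRiemannianBundle (𝓡 m) ∞ (EuclideanSpace ℝ (Fin m))
    (fun x : M ↦ TangentSpace (𝓡 m) x)]
  [IsContMDiffRiemannianBundle (𝓡 n) ∞ (EuclideanSpace ℝ (Fin n))
    (fun y : N ↦ TangentSpace (𝓡 n) y)]

/-- The derivative of `ln λ_i` in a vertical direction. -/
theorem mvfderiv_log_lam (h : IsAdaptedEigenframeOn (m := m) (n := n) φ U E V lam)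
    (hU : IsOpen U) (hφ : ContMDiff (𝓡 m) (𝓡 n) ∞ φ) (hx : x ∈ U) (i : Fin n) :
    MDifferentiableAt (𝓡 m) 𝓘(ℝ, ℝ) (fun y ↦ Real.log (lam i y)) x ∧
    ∀ α, mvfderiv (𝓡 m) (fun y ↦ Real.log (lam i y)) x (V α x) =
      inner ℝ (covDeriv (E i) x (E i x)) (V α x) := by
  have hxs := mem_extChartAt_source (I := 𝓡 m) x
  have ht := mem_extChartAt_target (I := 𝓡 m) x
  have hl := (extChartAt (𝓡 m) x).left_inv hxs
  have hφx := mem_extChartAt_source (I := 𝓡 n) (φ x)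
  have hE := h.isEigenfield_E hU hφ hx i
  have hG := isMetricAt_chartMetric ht
  have hH : IsMetricAt (chartMetric (φ x)) (chartMap m n x (φ x) φ (extChartAt (𝓡 m) x x)) := by
    rw [chartMap_extChartAt hxs]
    exact isMetricAt_chartMetric (mem_extChartAt_target _)
  have hf : ContDiffAt ℝ ∞ (chartMap m n x (φ x) φ) (extChartAt (𝓡 m) x x) :=
    contDiffAt_chartMap hφ ht (by rwa [hl])
  have hd := hE.differentiableAt_eigenvalue hH hf
  have hpos : lam i ((extChartAt (𝓡 m) x).symm (extChartAt (𝓡 m) x x)) ^ 2 ≠ 0 := by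
    rw [hl]
    exact pow_ne_zero _ (h.lam_pos hx i).ne'
  have hlog := (hd.hasFDerivAt.log hpos).const_mul (1 / 2 : ℝ)
  -- Differentiability is known for `λ_i²`, not directly for `λ_i`; hence `ln λ_i = ½ ln λ_i²`.
  have hev : ∀ᶠ q in 𝓝 x, Real.log (lam i q) = 1 / 2 *
      Real.log (lam i ((extChartAt (𝓡 m) x).symm (extChartAt (𝓡 m) x q)) ^ 2) := by
    filter_upwards [(isOpen_extChartAt_source x).mem_nhds hxs] with q hq
    rw [(extChartAt (𝓡 m) x).left_inv hq, Real.log_pow]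
    push_cast
    ring
  refine ⟨?_, fun α ↦ ?_⟩
  · have := isManifold_one (m := m) (M := M)
    refine MDifferentiableAt.congr_of_eventuallyEq ?_ hev
    exact hlog.differentiableAt.comp_mdifferentiableAt
      (mdifferentiableAt_extChartAt (by rwa [extChartAt_source] at hxs))
  · rw [mvfderiv_eq_fderiv hxs hlog.differentiableAt hev, hlog.fderiv,
      ← chartField_extChartAt hxs, inner_covDeriv, ← chartField_extChartAt hxs,
      ← chartField_extChartAt hxs]
    have horth : ∀ᶠ p in 𝓝 x, inner ℝ (E i p) (V α p) = 0 :=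
      (h.isSplitFrameAt_horizontal hU hx).inner_eq_zero.mono fun p hp ↦ hp i α
    have := hE.fderiv_eigenvalue_vertical hG hH hf (h.differentiableAt_V hU hx α)
      (h.fderiv_chartField_V hU hφ hx α)
      (eventually_inner_chartField (P := (· = 0)) hxs horth)
    simp only [smul_apply, smul_eq_mul, this]
    have hc : ∀ c r : ℝ, c ≠ 0 → 1 / 2 * (c⁻¹ * (2 * c * r)) = r := fun c r hc ↦ by field_simp
    exact hc _ _ hpos

theorem meanCurvature_horizontal_eq (h : IsAdaptedEigenframeOn (m := m) (n := n) φ U E V lam)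
    (hU : IsOpen U) (hφ : ContMDiff (𝓡 m) (𝓡 n) ∞ φ) (hx : x ∈ U) :
    meanCurvature (horizontal (m := m) (n := n) φ) x = (1 / (n : ℝ)) •
      ∑ α, (∑ i, mvfderiv (𝓡 m) (fun y ↦ Real.log (lam i y)) x (V α x)) • V α x := by
  rw [(h.isSplitFrameAt_horizontal hU hx).meanCurvature_eq, Fintype.card_fin, one_div]
  simp only [(h.mvfderiv_log_lam hU hφ hx _).2]

theorem meanCurvature_horizontal (h : IsAdaptedEigenframeOn (m := m) (n := n) φ U E V lam)
    (hU : IsOpen U) (hφ : ContMDiff (𝓡 m) (𝓡 n) ∞ φ) (hx : x ∈ U) :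
    meanCurvature (horizontal (m := m) (n := n) φ) x = (1 / (n : ℝ)) •
      verticalGrad (m := m) (n := n) φ (fun y ↦ Real.log (∏ i, lam i y)) x := by
  rw [h.meanCurvature_horizontal_eq hU hφ hx, h.verticalGrad_eq hU hx]
  congr 1
  refine Finset.sum_congr rfl fun α _ ↦ ?_
  congr 1
  -- The logarithm of the product splits only where every factor is nonzero, which is guaranteed on
  -- the neighbourhood `U` of `x`.
  have h1 : (fun y ↦ Real.log (∏ i, lam i y)) =ᶠ[𝓝 x] ∑ i, fun y ↦ Real.log (lam i y) := by
    filter_upwards [hU.mem_nhds hx] with y hy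
    rw [Finset.sum_apply, Real.log_prod fun i _ ↦ (h.lam_pos hy i).ne']
  have h2 := HasMFDerivAt.sum (t := Finset.univ)
    fun i _ ↦ (h.mvfderiv_log_lam hU hφ hx i).1.hasMFDerivAt
  have h3 := h1.mfderiv_eq (I := 𝓡 m) (I' := 𝓘(ℝ, ℝ))
  rw [h2.mfderiv] at h3
  have h4 := DFunLike.congr_fun h3 (V α x)
  exact (h4.trans (sum_apply Finset.univ
    (fun i ↦ mvfderiv (𝓡 m) (fun y ↦ Real.log (lam i y)) x) (V α x))).symm

theorem meanCurvature_horizontal_of_conformal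
    (h : IsAdaptedEigenframeOn (m := m) (n := n) φ U E V lam)
    (hU : IsOpen U) (hφ : ContMDiff (𝓡 m) (𝓡 n) ∞ φ) (hx : x ∈ U) {dil : M → ℝ}
    (hdil : IsHorizontallyWeaklyConformal (m := m) (n := n) φ dil) :
    meanCurvature (horizontal (m := m) (n := n) φ) x =
      verticalGrad (m := m) (n := n) φ (fun y ↦ Real.log (dil y)) x := by
  rw [h.meanCurvature_horizontal_eq hU hφ hx, h.verticalGrad_eq hU hx]
  rcases Nat.eq_zero_or_pos n with rfl | hn
  -- For `n = 0` the target has zero tangent spaces, so `dφ = 0` and the dilation vanishes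
  -- everywhere. Its logarithm is then constant, and both sides are zero.
  · have h0 : ∀ y, dil y = 0 := fun y ↦ hdil.dil_eq_zero y <| by
      ext v
      exact Subsingleton.elim (α := EuclideanSpace ℝ (Fin 0)) _ _
    have h1 : mvfderiv (𝓡 m) (fun y ↦ Real.log (dil y)) x = 0 := by
      simp only [h0]
      exact mvfderiv_const _
    simp [h1]
  · have h1 : ∀ i, (fun y ↦ Real.log (lam i y)) =ᶠ[𝓝 x] fun y ↦ Real.log (dil y) := fun i ↦ by
      filter_upwards [hU.mem_nhds hx] with y hy
      rw [h.lam_eq_dil hdil hy]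
    have h2 : ∀ i v, mvfderiv (𝓡 m) (fun y ↦ Real.log (lam i y)) x v =
        mvfderiv (𝓡 m) (fun y ↦ Real.log (dil y)) x v := fun i v ↦
      DFunLike.congr_fun (h1 i).mfderiv_eq v
    have hn' : (n : ℝ) ≠ 0 := by positivity
    simp only [h2, Finset.sum_const, Finset.card_univ, Fintype.card_fin, Finset.smul_sum,
      smul_smul, nsmul_eq_mul]
    refine Finset.sum_congr rfl fun α _ ↦ ?_
    congr 1
    field_simp

/-- At each point of the domain of an adapted frame, the tension field vanishes if and only if
the harmonicity equations hold. -/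
theorem tension_eq_zero_iff (h : IsAdaptedEigenframeOn (m := m) (n := n) φ U E V lam)
    (hU : IsOpen U) (hφ : ContMDiff (𝓡 m) (𝓡 n) ∞ φ) (hx : x ∈ U) :
    tension (m := m) (n := n) φ x = 0 ↔ HarmonicityEquations (m := m) (n := n) φ E lam x := by
  have hxs := mem_extChartAt_source (I := 𝓡 m) x
  have ht := mem_extChartAt_target (I := 𝓡 m) x
  have hl := (extChartAt (𝓡 m) x).left_inv hxs
  have hφx := mem_extChartAt_source (I := 𝓡 n) (φ x)
  have hE := h.isEigenfield_E hU hφ hx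
  set a := extChartAt (𝓡 m) x x with ha
  set f := chartMap m n x (φ x) φ with hfdef
  set G := chartMetric (m := m) x
  set H := chartMetric (m := n) (φ x)
  set l : Fin n → EuclideanSpace ℝ (Fin m) → ℝ :=
    fun i y ↦ lam i ((extChartAt (𝓡 m) x).symm y) ^ 2 with hldef
  set e : Fin n → EuclideanSpace ℝ (Fin m) → EuclideanSpace ℝ (Fin m) :=
    fun i ↦ chartField x (E i) with hedef
  set u : Fin (m - n) → EuclideanSpace ℝ (Fin m) → EuclideanSpace ℝ (Fin m) :=
    fun α ↦ chartField x (V α) with hudef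
  have hG : IsMetricAt G a := isMetricAt_chartMetric ht
  have hH : IsMetricAt H (f a) := by
    rw [hfdef, ha, chartMap_extChartAt hxs]
    exact isMetricAt_chartMetric (mem_extChartAt_target _)
  have hf : ContDiffAt ℝ ∞ f a := contDiffAt_chartMap hφ ht (by rwa [hl])
  have hea : ∀ i, e i a = components x x (E i x) := fun i ↦ chartField_extChartAt hxs _
  have hua : ∀ α, u α a = components x x (V α x) := fun i ↦ chartField_extChartAt hxs _
  have hla : ∀ i, l i a = lam i x ^ 2 := fun i ↦ by simp only [hldef, hl]
  have hexp : ∀ w, w = ∑ i, G a (e i a) w • e i a + ∑ α, G a (u α a) w • u α a := fun w ↦ by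
    conv_lhs => rw [← components_ofComponents hxs w, eq_sum_of_orthonormal (h.orthonormal x hx)
      (by rw [h.card_add hx, finrank_tangentSpace]) (ofComponents x x w)]
    simp only [map_add, map_sum, map_smul, inner_eq_chartMetric hxs, components_ofComponents hxs,
      hea, hua]
    rfl
  set T := ∑ i, hess G H f a (e i a) (e i a) + ∑ α, hess G H f a (u α a) (u α a) with hT
  have hten : tension (m := m) (n := n) φ x = ofComponents (φ x) (φ x) T := by
    rw [tension_eq hφ hxs hφx (EuclideanSpace.basisFun (Fin m) ℝ).toBasis]
    congr 1
    refine (laplace_eq_sum _ hG (b := Sum.elim (fun i ↦ e i a) (fun α ↦ u α a)) ?_).trans ?_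
    · intro w
      rw [Fintype.sum_sum_type]
      exact hexp w
    · rw [Fintype.sum_sum_type]
      rfl
  -- The vectors `df (e k)` span the target, since `df` is surjective and kills every `u α`;
  -- nondegeneracy of `H` does the rest.
  have hT0 : T = 0 ↔ ∀ k, H (f a) T (fderiv ℝ f a (e k a)) = 0 := by
    refine ⟨fun h0 k ↦ by rw [h0]; simp, fun h0 ↦ hH.ext_left fun z ↦ ?_⟩
    obtain ⟨w, hw⟩ := h.subset_regularSet hx (ofComponents (φ x) (φ x) z)
    have hz : z = fderiv ℝ f a (components x x w) := by
      rw [hfdef, ha, fderiv_chartMap_components hφ hxs hφx, hw, components_ofComponents hφx]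
    rw [hz, hexp (components x x w)]
    have h1 : ∀ α, fderiv ℝ f a (u α a) = 0 := fun α ↦
      (h.fderiv_chartField_V hU hφ hx α).self_of_nhds
    simp [h0, h1]
  have hval : ∀ k, H (f a) T (fderiv ℝ f a (e k a)) =
      fderiv ℝ (l k) a (e k a) - 1 / 2 * ∑ i, fderiv ℝ (l i) a (e k a) +
        ∑ i, (l i a - l k a) * G a (nabla G (e i) a (e i a)) (e k a) -
        l k a * ∑ α, G a (nabla G (u α) a (u α a)) (e k a) := fun k ↦ by
    -- The `if` term merges two cases: for `i = k` the value is `½ E_k(λ_k²)`, written as `E_k(λ_k²)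
    -- - ½ E_k(λ_k²)`, and the factor `l i a - l k a` vanishes.
    have h1 : ∀ i, H (f a) (hess G H f a (e i a) (e i a)) (fderiv ℝ f a (e k a)) =
        (if i = k then fderiv ℝ (l k) a (e k a) else 0) - 1 / 2 * fderiv ℝ (l i) a (e k a) +
        (l i a - l k a) * G a (nabla G (e i) a (e i a)) (e k a) := fun i ↦ by
      by_cases hik : i = k
      · subst hik
        rw [(hE i).metric_hess_self hG hH hf, if_pos rfl]
        ring
      · have horth : ∀ᶠ p in 𝓝 x, inner ℝ (E i p) (E k p) = 0 :=
          (h.isSplitFrameAt_horizontal hU hx).inner_eq_ite.mono fun p hp ↦ by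
            rw [hp i k, if_neg hik]
        rw [(hE i).metric_hess_orthogonal hG hH hf (hE k)
          (eventually_inner_chartField (P := (· = 0)) hxs horth), if_neg hik]
        ring
    have h2 : ∀ α, H (f a) (hess G H f a (u α a) (u α a)) (fderiv ℝ f a (e k a)) =
        - (l k a * G a (nabla G (u α) a (u α a)) (e k a)) := fun α ↦
      (hE k).metric_hess_vertical hG hH hf (h.differentiableAt_V hU hx α)
        (h.fderiv_chartField_V hU hφ hx α)
    rw [hT]
    simp only [map_add, map_sum, add_apply, sum_apply, h1, h2, Finset.sum_add_distrib,
      Finset.sum_sub_distrib, Finset.sum_neg_distrib, ← Finset.mul_sum, Finset.sum_ite_eq',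
      Finset.mem_univ, if_true]
    ring
  rw [hten, ofComponents_eq_zero_iff hφx, hT0]
  refine forall_congr' fun k ↦ ?_
  have hd : ∀ i, DifferentiableAt ℝ (l i) a := fun i ↦ (hE i).differentiableAt_eigenvalue hH hf
  have hder : mvfderiv (𝓡 m) (fun y ↦ energyDensity (m := m) (n := n) φ y - lam k y ^ 2) x
      (E k x) = 1 / 2 * ∑ i, fderiv ℝ (l i) a (e k a) - fderiv ℝ (l k) a (e k a) := by
    have h1 : HasFDerivAt (fun y ↦ 1 / 2 * ∑ i, l i y - l k y)
        ((1 / 2 : ℝ) • ∑ i, fderiv ℝ (l i) a - fderiv ℝ (l k) a) a :=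
      ((HasFDerivAt.fun_sum fun i _ ↦ (hd i).hasFDerivAt).const_mul _).sub (hd k).hasFDerivAt
    rw [mvfderiv_eq_fderiv (c := x) hxs (g' := fun y ↦ 1 / 2 * ∑ i, l i y - l k y)
      h1.differentiableAt ?_, h1.fderiv, hea]
    · simp [sum_apply]
    · filter_upwards [hU.mem_nhds hx, (isOpen_extChartAt_source x).mem_nhds hxs] with q hq hq'
      rw [h.energyDensity_eq hq]
      simp only [hldef, (extChartAt (𝓡 m) x).left_inv hq']
  have hcov : ∀ Y : Π p : M, TangentSpace (𝓡 m) p,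
      inner ℝ (covDeriv Y x (Y x)) (E k x) =
        G a (nabla G (chartField x Y) a (chartField x Y a)) (e k a) := fun Y ↦ by
    rw [inner_covDeriv, hea, ha, chartField_extChartAt hxs]
  have hcurv := h.sum_inner_covDeriv_V hU hx k
  simp only [hcov] at hcurv
  rw [hval, hder, mul_right_comm, hcurv]
  simp only [hcov, hla]
  -- The pairing of `T` with `df (e k)` is the right side of the equation minus the left one, which
  -- accounts for the sign.
  constructor <;> intro h0 <;> linear_combination -h0

end IsAdaptedEigenframeOn

end Eigenframe

end RiemMap

/-! ### The theorem, assembled from the pointwise results and density -/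

theorem mainTheorem5 {m n : ℕ}
    {M : Type*} [TopologicalSpace M] [ChartedSpace (EuclideanSpace ℝ (Fin m)) M]
    [IsManifold (𝓡 m) ∞ M]
    [RiemannianBundle (fun x : M ↦ TangentSpace (𝓡 m) x)]
    [IsContMDiffRiemannianBundle (𝓡 m) ∞ (EuclideanSpace ℝ (Fin m))
      (fun x : M ↦ TangentSpace (𝓡 m) x)]
    {N : Type*} [TopologicalSpace N] [ChartedSpace (EuclideanSpace ℝ (Fin n)) N]
    [IsManifold (𝓡 n) ∞ N]
    [RiemannianBundle (fun y : N ↦ TangentSpace (𝓡 n) y)]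
    [IsContMDiffRiemannianBundle (𝓡 n) ∞ (EuclideanSpace ℝ (Fin n))
      (fun y : N ↦ TangentSpace (𝓡 n) y)]
    (φ : M → N) (hφ : ContMDiff (𝓡 m) (𝓡 n) ∞ φ)
    (hsub : RiemMap.IsAlmostSubmersion (m := m) (n := n) φ)
    -- adapted orthonormal eigenframes of the first fundamental form on open sets `U a`
    {ι : Type*} (U : ι → Set M) (hU : ∀ a, IsOpen (U a))
    (E : ι → Fin n → Π x : M, TangentSpace (𝓡 m) x)
    (V : ι → Fin (m - n) → Π x : M, TangentSpace (𝓡 m) x)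
    (lam : ι → Fin n → M → ℝ)
    (hframe : ∀ a, RiemMap.IsAdaptedEigenframeOn (m := m) (n := n) φ (U a) (E a) (V a) (lam a)) :
    -- the mean curvature of the horizontal distribution
    (∀ a, ∀ x ∈ U a,
      RiemMap.meanCurvature (RiemMap.horizontal (m := m) (n := n) φ) x =
        (1 / (n : ℝ)) • RiemMap.verticalGrad (m := m) (n := n) φ
          (fun y ↦ Real.log (∏ i, lam a i y)) x) ∧
    -- the horizontally weakly conformal case
    (∀ dil : M → ℝ, RiemMap.IsHorizontallyWeaklyConformal (m := m) (n := n) φ dil →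
      ∀ a, ∀ x ∈ U a,
        RiemMap.meanCurvature (RiemMap.horizontal (m := m) (n := n) φ) x =
          RiemMap.verticalGrad (m := m) (n := n) φ (fun y ↦ Real.log (dil y)) x) ∧
    -- harmonicity on the domain of each frame
    (∀ a, RiemMap.IsHarmonicOn (m := m) (n := n) φ (U a) ↔
      ∀ x ∈ U a, RiemMap.HarmonicityEquations (m := m) (n := n) φ (E a) (lam a) x) ∧
    -- harmonicity on `M`, when the domains of the frames together are dense in `M`
    (Dense (⋃ a, U a) →
      (RiemMap.IsHarmonic (m := m) (n := n) φ ↔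
        ∀ a, ∀ x ∈ U a,
          RiemMap.HarmonicityEquations (m := m) (n := n) φ (E a) (lam a) x)) := by
  have hten := fun a x hx ↦ (hframe a).tension_eq_zero_iff (x := x) (hU a) hφ hx
  refine ⟨fun a x hx ↦ (hframe a).meanCurvature_horizontal (hU a) hφ hx,
    fun dil hdil a x hx ↦ (hframe a).meanCurvature_horizontal_of_conformal (hU a) hφ hx hdil,
    fun a ↦ forall₂_congr (hten a), fun hd ↦ ⟨fun h a x hx ↦ (hten a x hx).1 (h x), fun h ↦ ?_⟩⟩
  refine RiemMap.isHarmonic_of_dense hφ hd fun x hx ↦ ?_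
  obtain ⟨a, ha⟩ := Set.mem_iUnion.1 hx
  exact (hten a x ha).2 (h a x ha)
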